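/- Let $f_\oplus$ be a probability density on $\mathbb{R}$ with finite second moment whose support $D_\oplus$ is an interval (possibly unbounded), and let $\mu(\mathrm{d}u)=f_\oplus(u)\,\mathrm{d}u$. Let $\mathcal{T}_{f_\oplus}$ be the closure in $L^2(\mathbb{R},\mu)$ of all $\lambda(T-\mathrm{id})$ with $\lambda>0$ and $T$ the optimal transport map (for quadratic cost) from $\mu$ to some probability measure $\nu$ on $\mathbb{R}$ with finite second moment. Assume: (A1) $|\beta|<1$. (A2) $\{\epsilon_t\}_{t\in\mathbb{Z}}$ are stochastic processes on $\mathbb{R}$ that are iid random elements of $\mathcal{T}_{f_\oplus}$, with $\mathbb{E}\,\epsilon_t(u)=0$ and, for $C_\epsilon(u,v)=\mathrm{Cov}(\epsilon_t(u),\epsilon_t(v))$, $\int_{\mathbb{R}} C_\epsilon(u,u)f_\oplus(u)\,\mathrm{d}u<\infty$; moreover this integral is positive (the innovations are not almost surely zero). Let $\{V_t\}_{t\in\mathbb{Z}}$ be the strictly stationary solution in $\mathcal{T}_{f_\oplus}$ of $V_t=\beta V_{t-1}+\epsilon_t$, $t\in\mathbb{Z}$. (A3) For every $t$, almost surely, $V_t$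 is differentiable on $D_\oplus$ with $V_t'(u)>-1$ for all $u\in D_\oplus$. (A4) $\int_{\mathbb{R}}\mathbb{E}[\epsilon_t^4(u)]\,f_\oplus(u)\,\mathrm{d}u<\infty$. Let $Q_t$ be the quantile function of the push-forward of $\mu$ under $V_t+\mathrm{id}$ (the measure with the random density $f_t$ of the WAR(1) model). For $n\ge 1$ let $\widehat F_\oplus=\bigl(\frac1n\sum_{t=1}^nQ_t\bigr)^{-1}$, $\hat f_\oplus=\widehat F_\oplus'$, $\widehat T_t=Q_t\circ\widehat F_\oplus$, $$\hat\eta_h(u)=\frac1n\sum_{t=1}^{n-h}\{\widehat T_t(u)-u\}\{\widehat T_{t+h}(u)-u\},\qquad \hat\beta=\hat\rho_1=\frac{\int_{\mathbb{R}}\hat\eta_1(u)\hat f_\oplus(u)\,\mathrm{d}u}{\int_{\mathbb{R}}\hat\eta_0(u)\hat f_\oplus(u)\,\mathrm{d}u}.$$ Then $$\sigma_\epsilon^2=\frac{\int_{\mathbb{R}^2}C_\epsilon^2(u,v)f_\oplus(u)f_\oplus(v)\,\mathrm{d}u\,\mathrm{d}v}{\bigl[\int_{\mathbb{R}}C_\epsilon(u,u)f_\oplus(u)\,\mathrm{d}u\bigr]^2}$$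 is finite, and, as $n\to\infty$, $$n^{1/2}(\hat\beta-\beta)\ \overset{D}{\longrightarrow}\ \mathbf{N}\bigl(0,\ \sigma_\epsilon^2(1-\beta^2)\bigr).$$ -/

import Mathlib

open MeasureTheory ProbabilityTheory Filter
open scoped ENNReal Topology

noncomputable section

namespace WAR

/-! ### Densities, Wasserstein space, optimal transport, tangent space -/

/-- The measure `f(u) du` on the real line. -/
def densMeasure (f : ℝ → ℝ) : Measure ℝ :=
  volume.withDensity fun u => ENNReal.ofReal (f u)

/-- `ν` belongs to the Wasserstein space: a probability measure on `ℝ` with finite second moment. -/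
def IsW2 (ν : Measure ℝ) : Prop :=
  IsProbabilityMeasure ν ∧ ∫⁻ x, ENNReal.ofReal (x ^ 2) ∂ν < ∞

/-- `f` is a probability density on `ℝ` with finite second moment. -/
def IsDensity (f : ℝ → ℝ) : Prop :=
  Measurable f ∧ (∀ u, 0 ≤ f u) ∧ IsW2 (densMeasure f)

/-- `T` is an optimal transport map from `μ` to `ν` for the quadratic cost. -/
def IsOptimalTransport (μ ν : Measure ℝ) (T : ℝ → ℝ) : Prop :=
  Measurable T ∧ μ.map T = ν ∧
    ∀ K : ℝ → ℝ, Measurable K → μ.map K = ν →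
      ∫⁻ u, ENNReal.ofReal ((T u - u) ^ 2) ∂μ ≤ ∫⁻ u, ENNReal.ofReal ((K u - u) ^ 2) ∂μ

/-- The tangent space at `μ`: the `L²(μ)`-closure of all `λ (T - id)`, where `λ > 0` and `T` is the
optimal transport map from `μ` to some element of the Wasserstein space. -/
def tangentSpace (μ : Measure ℝ) : Set (Lp ℝ 2 μ) :=
  closure {w | ∃ (c : ℝ) (ν : Measure ℝ) (T : ℝ → ℝ), 0 < c ∧ IsW2 ν ∧
    IsOptimalTransport μ ν T ∧ ∀ᵐ u ∂μ, w u = c * (T u - u)}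

/-- The function `g` (more precisely its class modulo `μ`-null sets) is in the tangent space. -/
def MemTangent (μ : Measure ℝ) (g : ℝ → ℝ) : Prop :=
  ∃ hg : MemLp g 2 μ, hg.toLp g ∈ tangentSpace μ

/-- The exponential map: `Exp_μ(V)` is the push-forward of `μ` under `V + id`. -/
def expMap (μ : Measure ℝ) (V : ℝ → ℝ) : Measure ℝ :=
  μ.map fun u => V u + u

/-- The quantile function of a probability measure on `ℝ`. -/
def quantile (ν : Measure ℝ) (s : ℝ) : ℝ :=
  sInf {x : ℝ | s ≤ cdf ν x}

/-! ### Random elements of the Hilbert space `L²(μ)` -/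

instance lpMeasurableSpace (μ : Measure ℝ) : MeasurableSpace (Lp ℝ 2 μ) := borel _

instance lpBorelSpace (μ : Measure ℝ) : BorelSpace (Lp ℝ 2 μ) := ⟨rfl⟩

open Classical in
/-- The class in `L²(μ)` of a square integrable function (and `0` for any other function). -/
def toL2 (μ : Measure ℝ) (g : ℝ → ℝ) : Lp ℝ 2 μ :=
  if hg : MemLp g 2 μ then hg.toLp g else 0

variable {Ω : Type*} [MeasurableSpace Ω]

/-- A sequence of (jointly measurable) stochastic processes indexed by the real line, which almost
surely are elements of the tangent space at `μ`. -/
structure IsTangentSequence (P : Measure Ω) (μ : Measure ℝ) (X : ℤ → Ω → ℝ → ℝ) : Prop where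
  measurable : ∀ t, Measurable (Function.uncurry (X t))
  mem_tangent : ∀ t, ∀ᵐ ω ∂P, MemTangent μ (X t ω)

/-- Strict stationarity: the joint laws in `L²(μ)^k` are invariant under time shifts. -/
def IsStrictlyStationary (P : Measure Ω) (μ : Measure ℝ) (X : ℤ → Ω → ℝ → ℝ) : Prop :=
  ∀ (k : ℕ) (τ : Fin k → ℤ) (h : ℤ),
    IdentDistrib (fun ω i => toL2 μ (X (τ i) ω)) (fun ω i => toL2 μ (X (τ i + h) ω)) P P

/-- The innovations: iid random elements of the tangent space at `μ` with mean zero and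
`∫ Var(ε_t(u)) dμ(u) < ∞`. -/
structure IsInnovation (P : Measure Ω) (μ : Measure ℝ) (ε : ℤ → Ω → ℝ → ℝ) : Prop where
  tangent : IsTangentSequence P μ ε
  indep : iIndepFun (fun t ω => toL2 μ (ε t ω)) P
  identDistrib : ∀ t, IdentDistrib (fun ω => toL2 μ (ε t ω)) (fun ω => toL2 μ (ε 0 ω)) P P
  mean_zero : ∀ t, ∀ᵐ u ∂μ, ∫ ω, ε t ω u ∂P = 0
  variance_lt_top : ∀ t, ∫⁻ u, evariance (fun ω => ε t ω u) P ∂μ < ∞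

/-- Finite integrated fourth moment of the innovations. -/
def HasFourthMoment (P : Measure Ω) (μ : Measure ℝ) (ε : ℤ → Ω → ℝ → ℝ) : Prop :=
  ∀ t, ∫⁻ u, ∫⁻ ω, ENNReal.ofReal (ε t ω u ^ 4) ∂P ∂μ < ∞

/-- `V` is a strictly stationary solution in the tangent space of `V_t = β V_{t-1} + ε_t`. -/
structure IsStationarySolution (P : Measure Ω) (μ : Measure ℝ) (β : ℝ)
    (ε V : ℤ → Ω → ℝ → ℝ) : Prop where
  tangent : IsTangentSequence P μ V
  stationary : IsStrictlyStationary P μ V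
  equation : ∀ t, ∀ᵐ ω ∂P, ∀ᵐ u ∂μ, V t ω u = β * V (t - 1) ω u + ε t ω u

/-- Almost surely, `V_t` is differentiable with `V_t' > -1` on the support of `μ`
(one-sided derivatives at the end points of the support). -/
def HasIncreasingTransport (P : Measure Ω) (μ : Measure ℝ) (V : ℤ → Ω → ℝ → ℝ) : Prop :=
  ∀ t, ∀ᵐ ω ∂P, ∀ u ∈ μ.support,
    DifferentiableWithinAt ℝ (V t ω) μ.support u ∧ -1 < derivWithin (V t ω) μ.support u

/-- The innovation covariance kernel `C_ε(u, v) = Cov(ε_t(u), ε_t(v))`. -/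
def innovCov (P : Measure Ω) (ε : ℤ → Ω → ℝ → ℝ) (u v : ℝ) : ℝ :=
  covariance (fun ω => ε 0 ω u) (fun ω => ε 0 ω v) P

/-- `σ_ε² = ∬ C_ε(u,v)² dμ(u) dμ(v) / (∫ C_ε(u,u) dμ(u))²`. -/
def sigmaSq (P : Measure Ω) (μ : Measure ℝ) (ε : ℤ → Ω → ℝ → ℝ) : ℝ :=
  (∫ p, innovCov P ε p.1 p.2 ^ 2 ∂(μ.prod μ)) / (∫ u, innovCov P ε u u ∂μ) ^ 2

/-! ### The estimators, as functions of the observed quantile functions `Q_1, …, Q_n` -/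

/-- `Q̂_⊕ = n⁻¹ ∑_{t=1}^n Q_t`. -/
def meanQuantile (Q : ℤ → ℝ → ℝ) (n : ℕ) (s : ℝ) : ℝ :=
  (n : ℝ)⁻¹ * ∑ t ∈ Finset.Icc (1 : ℤ) n, Q t s

/-- `F̂_⊕ = (n⁻¹ ∑_{t=1}^n Q_t)⁻¹`, the (right-continuous) inverse of the mean quantile function;
it is `0` below the range of the mean quantile function and `1` above it. -/
def meanCdf (Q : ℤ → ℝ → ℝ) (n : ℕ) (u : ℝ) : ℝ :=
  sSup {s : ℝ | s ∈ Set.Ioo (0 : ℝ) 1 ∧ meanQuantile Q n s ≤ u}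

/-- `f̂_⊕ = F̂_⊕'`. -/
def meanDens (Q : ℤ → ℝ → ℝ) (n : ℕ) (u : ℝ) : ℝ :=
  deriv (meanCdf Q n) u

/-- `T̂_t = Q_t ∘ F̂_⊕`. -/
def estTransport (Q : ℤ → ℝ → ℝ) (n : ℕ) (t : ℤ) (u : ℝ) : ℝ :=
  Q t (meanCdf Q n u)

/-- `η̂_h(u) = n⁻¹ ∑_{t=1}^{n-h} (T̂_t(u) - u) (T̂_{t+h}(u) - u)`. -/
def estAutocov (Q : ℤ → ℝ → ℝ) (n h : ℕ) (u : ℝ) : ℝ :=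
  (n : ℝ)⁻¹ * ∑ t ∈ Finset.Icc (1 : ℤ) ((n : ℤ) - h),
    (estTransport Q n t u - u) * (estTransport Q n (t + h) u - u)

/-- `ρ̂_h = ∫ η̂_h(u) f̂_⊕(u) du / ∫ η̂_0(u) f̂_⊕(u) du`. -/
def estAutocorr (Q : ℤ → ℝ → ℝ) (n h : ℕ) : ℝ :=
  (∫ u, estAutocov Q n h u * meanDens Q n u) / (∫ u, estAutocov Q n 0 u * meanDens Q n u)

/-- `β̂ = ρ̂_1`, computed from the quantile functions of the random measures `Exp_μ(V_t)`,
`t = 1, …, n`. -/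
def betaHat (μ : Measure ℝ) (V : ℤ → Ω → ℝ → ℝ) (n : ℕ) (ω : Ω) : ℝ :=
  estAutocorr (fun t => quantile (expMap μ (V t ω))) n 1

end WAR

end

/-! The estimator is exactly an empirical autocorrelation in the Hilbert space `L²(μ)`. Since `V_t +
id` is strictly increasing on the support, `Q_t ∘ F = V_t + id` with `F` the distribution function
of `μ`. Hence `F̂` is the distribution function of the image of `μ` under the mean map `M = V̄ +
id`, and `f̂` is its density. Changing variables by `M` turns `T̂_t - id` into `V_t - V̄` and `f̂(u)
du` into `μ` (`integral_estAutocov`, `betaHat_eq`).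

What remains is a scalar-coefficient AR(1) process in a Hilbert space. If `N` and `D` are the
unnormalized autocovariances of lags one and zero, then `N - β D` is `∑ ⟨V_k, ε_{k+1}⟩` plus
boundary and mean terms bounded in `L¹` (`empAutocov_one_sub`, `tendstoInMeasure_remainder`). The
sum consists of martingale differences whose squares decorrelate geometrically from the remote past,
so it obeys a central limit theorem (`IsMixingDifference.tendstoInDistribution`), while `D / n`
tends to `E‖V_0‖²` in probability. Slutsky's lemma gives a normal limit with variance `E⟨V_0, ε_1⟩²
/ (E‖V_0‖²)²`.

One step of the recursion gives `(1 - β²) E‖V_0‖² = E‖ε_0‖²` and `(1 - β²) E⟨V_0, ε_1⟩² = E⟨ε_0,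
ε_1⟩²`. By Fubini `E‖ε_0‖² = ∫ C_ε(u,u) dμ` and `E⟨ε_0, ε_1⟩² = ∬ C_ε² dμ dμ`
(`integral_inner_toL2_sq`), whence the stated variance. Causality and moments of `V` are not
assumed; they follow from stationarity (`exists_isCausalAR`). -/

noncomputable section

set_option linter.unusedSectionVars false

namespace WAR

/-! ### Reduction of the estimator to an integral against `μ`, for a fixed realization. -/

section Deterministic

variable {μ : Measure ℝ} [IsProbabilityMeasure μ]

/-- The points of the support at which the distribution function lies in `(0, 1)`. -/
def core (μ : Measure ℝ) : Set ℝ := {u | u ∈ μ.support ∧ cdf μ u ∈ Set.Ioo (0 : ℝ) 1}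

/-- Between two points of an interval support lies a third, all of whose neighbourhoods are charged.
-/
lemma cdf_strictMonoOn_support (hS : μ.support.OrdConnected) :
    StrictMonoOn (cdf μ) μ.support := by
  intro u hu v hv huv
  obtain ⟨w, huw, hwv⟩ := exists_between huv
  have hw : w ∈ μ.support := hS.out hu hv ⟨huw.le, hwv.le⟩
  have hpos : 0 < μ (Set.Ioo u v) :=
    (Measure.mem_support_iff_forall w).1 hw _ (Ioo_mem_nhds huw hwv)
  have hdisj : Disjoint (Set.Iic u) (Set.Ioo u v) :=
    Set.disjoint_left.2 fun x hx hx' => not_lt.2 hx hx'.1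
  have hle : μ.real (Set.Iic u ∪ Set.Ioo u v) ≤ μ.real (Set.Iic v) :=
    measureReal_mono (Set.union_subset (Set.Iic_subset_Iic.2 huv.le) fun x hx => hx.2.le)
  rw [measureReal_union hdisj measurableSet_Ioo] at hle
  have : 0 < μ.real (Set.Ioo u v) := by
    rw [measureReal_def, ENNReal.toReal_pos_iff]
    exact ⟨hpos, measure_lt_top _ _⟩
  rw [cdf_eq_real, cdf_eq_real]
  linarith

lemma continuous_cdf [NullSingletonClass μ] : Continuous (cdf μ) := by
  rw [continuous_iff_continuousAt]
  intro x
  rw [(cdf μ).mono.continuousAt_iff_leftLim_eq_rightLim, (cdf μ).rightLim_eq]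
  have h : (cdf μ).measure {x} = 0 := by rw [measure_cdf]; exact measure_singleton x
  rw [StieltjesFunction.measure_singleton, ENNReal.ofReal_eq_zero] at h
  exact le_antisymm ((cdf μ).mono.leftLim_le le_rfl) (by linarith)

/-- On the support each level of the distribution function is attained at most once, so the levels 0
and 1 cost only null singletons. -/
lemma ae_mem_core [NullSingletonClass μ] (hS : μ.support.OrdConnected) : ∀ᵐ u ∂μ, u ∈ core μ := by
  have hlev : ∀ c : ℝ, ∀ᵐ u ∂μ, u ∈ μ.support → cdf μ u ≠ c := by
    intro c
    have hsub : Set.Subsingleton {u | u ∈ μ.support ∧ cdf μ u = c} := fun u hu v hv =>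
      (cdf_strictMonoOn_support hS).injOn hu.1 hv.1 (hu.2.trans hv.2.symm)
    have := hsub.countable.measure_zero μ
    rw [measure_eq_zero_iff_ae_notMem] at this
    filter_upwards [this] with u hu h1 h2 using hu ⟨h1, h2⟩
  filter_upwards [hlev 0, hlev 1, (Measure.support_mem_ae : μ.support ∈ ae μ)] with u h0 h1 hu
  exact ⟨hu, lt_of_le_of_ne (cdf_nonneg μ u) (h0 hu).symm, lt_of_le_of_ne (cdf_le_one μ u) (h1 hu)⟩

/-- The least point at which the distribution function reaches `s` works: the function is below `s`
to its left, so every left neighbourhood has mass and the point is in the support. -/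
lemma exists_mem_core [NullSingletonClass μ] {s : ℝ} (hs : s ∈ Set.Ioo (0 : ℝ) 1) :
    ∃ u ∈ core μ, cdf μ u = s := by
  have hcont : Continuous (cdf μ) := continuous_cdf
  obtain ⟨a, ha⟩ := ((tendsto_cdf_atBot μ).eventually_lt_const hs.1).exists
  obtain ⟨b, hb⟩ := ((tendsto_cdf_atTop μ).eventually_const_lt hs.2).exists
  set A : Set ℝ := {x | s ≤ cdf μ x} with hA
  have hAne : A.Nonempty := ⟨b, hb.le⟩
  have hAbdd : BddBelow A := ⟨a, fun x hx => le_of_not_gt fun h =>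
    absurd ((cdf μ).mono h.le) (not_le.2 (ha.trans_le hx))⟩
  have hAcl : IsClosed A := isClosed_le continuous_const hcont
  have hmem : sInf A ∈ A := hAcl.csInf_mem hAne hAbdd
  have hlt : ∀ x < sInf A, cdf μ x < s := fun x hx => not_le.1 fun h =>
    absurd (csInf_le hAbdd h) (not_le.2 hx)
  have heq : cdf μ (sInf A) = s := by
    refine le_antisymm ?_ hmem
    refine le_of_tendsto (hcont.continuousWithinAt (s := Set.Iio (sInf A)) (x := sInf A)) ?_
    filter_upwards [self_mem_nhdsWithin] with x hx using (hlt x hx).le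
  refine ⟨sInf A, ⟨?_, by rwa [heq]⟩, heq⟩
  rw [Measure.mem_support_iff_forall]
  intro U hU
  obtain ⟨l, r, hlr, hsub⟩ := mem_nhds_iff_exists_Ioo_subset.1 hU
  obtain ⟨l', hl', hl''⟩ := exists_between hlr.1
  have h1 : Set.Ioc l' (sInf A) ⊆ U := fun x hx => hsub ⟨hl'.trans hx.1, hx.2.trans_lt hlr.2⟩
  refine lt_of_lt_of_le ?_ (measure_mono h1)
  rw [← measure_cdf μ, StieltjesFunction.measure_Ioc, ENNReal.ofReal_pos, heq]
  linarith [hlt _ hl'']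

lemma cdf_map_apply {T : ℝ → ℝ} (hT : Measurable T) (x : ℝ) :
    cdf (μ.map T) x = μ.real {w | T w ≤ x} := by
  have : IsProbabilityMeasure (μ.map T) := Measure.isProbabilityMeasure_map hT.aemeasurable
  rw [cdf_eq_real, map_measureReal_apply hT measurableSet_Iic]
  rfl

/-- If `x < T u`, continuity gives `w < u` in the support with `x < T w`; then `{T ≤ x}` lies below
`w` almost everywhere, and its mass is at most `F w < F u`. -/
lemma quantile_map_cdf [NullSingletonClass μ] (hS : μ.support.OrdConnected) {T : ℝ → ℝ}
    (hT : Measurable T) (hTc : ContinuousOn T μ.support) (hTm : StrictMonoOn T μ.support)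
    {u : ℝ} (hu : u ∈ core μ) : quantile (μ.map T) (cdf μ u) = T u := by
  have hae : ∀ᵐ w ∂μ, w ∈ μ.support := Measure.support_mem_ae
  refine IsLeast.csInf_eq ⟨?_, ?_⟩
  · rw [Set.mem_ofPred_eq, cdf_map_apply hT, cdf_eq_real]
    refine ENNReal.toReal_mono (measure_ne_top _ _) (measure_mono_ae ?_)
    filter_upwards [hae] with w hw hwu using hTm.monotoneOn hw hu.1 hwu
  · intro x hx
    rw [Set.mem_ofPred_eq, cdf_map_apply hT] at hx
    by_contra! hlt
    -- A left end point of the support is excluded: there the distribution function would vanish.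
    obtain ⟨w₀, hw₀, hw₀u⟩ : ∃ w ∈ μ.support, w < u := by
      by_contra! h
      have : μ.real (Set.Iic u) ≤ μ.real {u} := by
        refine ENNReal.toReal_mono (measure_ne_top _ _) (measure_mono_ae ?_)
        filter_upwards [hae] with w hw hwu using le_antisymm hwu (h w hw)
      rw [← cdf_eq_real, measureReal_def, measure_singleton] at this
      exact absurd hu.2.1 (not_lt.2 (by simpa using this))
    have hev : ∀ᶠ w in 𝓝[μ.support] u, x < T w := (hTc u hu.1).eventually_const_lt hlt
    have hIoo : Set.Ico w₀ u ⊆ μ.support := fun w hw => hS.out hw₀ hu.1 ⟨hw.1, hw.2.le⟩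
    have hev' : ∀ᶠ w in 𝓝[<] u, x < T w ∧ w ∈ μ.support := by
      have hmem : Set.Ico w₀ u ∈ 𝓝[<] u := Ico_mem_nhdsLT hw₀u
      have h1 : 𝓝[<] u ≤ 𝓝[μ.support] u := by
        rw [nhdsWithin_le_iff]
        exact mem_of_superset hmem hIoo
      filter_upwards [h1 hev, hmem] with w h h' using ⟨h, hIoo h'⟩
    obtain ⟨w, ⟨hw1, hw2⟩, hw3⟩ := (hev'.and self_mem_nhdsWithin).exists
    have hle : μ.real {v | T v ≤ x} ≤ μ.real (Set.Iic w) := by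
      refine ENNReal.toReal_mono (measure_ne_top _ _) (measure_mono_ae ?_)
      filter_upwards [hae] with v hv hvx
      refine le_of_not_gt fun h => ?_
      have := hTm hw2 hv h
      have hvx' : T v ≤ x := hvx
      linarith
    rw [← cdf_eq_real] at hle
    have := cdf_strictMonoOn_support hS hw2 hu.1 hw3
    linarith

variable {Q : ℤ → ℝ → ℝ} {T : ℤ → ℝ → ℝ}

/-- `n⁻¹ ∑_{t=1}^n T_t`. -/
def meanMap (T : ℤ → ℝ → ℝ) (n : ℕ) (u : ℝ) : ℝ := (n : ℝ)⁻¹ * ∑ t ∈ Finset.Icc (1 : ℤ) n, T t u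

lemma meanQuantile_cdf (hQ : ∀ t, ∀ u ∈ core μ, Q t (cdf μ u) = T t u) (n : ℕ) {u : ℝ}
    (hu : u ∈ core μ) : meanQuantile Q n (cdf μ u) = meanMap T n u := by
  simp only [meanQuantile, meanMap, hQ _ u hu]

/-- The set whose supremum defines `meanCdf` is squeezed between `(0, c)` and `(0, c]`, because
every level in `(0, 1)` is `F u` for some `u` in the core. -/
lemma meanCdf_eq_cdf_map [NullSingletonClass μ] (hS : μ.support.OrdConnected)
    (hQ : ∀ t, ∀ u ∈ core μ, Q t (cdf μ u) = T t u) (n : ℕ)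
    (hm : Measurable (meanMap T n)) (hmono : StrictMonoOn (meanMap T n) μ.support) (x : ℝ) :
    meanCdf Q n x = cdf (μ.map (meanMap T n)) x := by
  set c := cdf (μ.map (meanMap T n)) x with hc
  have hc0 : 0 ≤ c := cdf_nonneg _ _
  have hc1 : c ≤ 1 := cdf_le_one _ _
  have hcr : c = μ.real {w | meanMap T n w ≤ x} := cdf_map_apply hm x
  have hae := ae_mem_core hS
  set E : Set ℝ := {s : ℝ | s ∈ Set.Ioo (0 : ℝ) 1 ∧ meanQuantile Q n s ≤ x} with hE
  have hub : E ⊆ Set.Ioc 0 c := by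
    rintro s ⟨hs, hsx⟩
    refine ⟨hs.1, ?_⟩
    obtain ⟨u, hu, rfl⟩ := exists_mem_core (μ := μ) hs
    rw [meanQuantile_cdf hQ n hu] at hsx
    rw [hcr, cdf_eq_real]
    refine ENNReal.toReal_mono (measure_ne_top _ _) (measure_mono_ae ?_)
    filter_upwards [hae] with w hw hwu using (hmono.monotoneOn hw.1 hu.1 hwu).trans hsx
  have hlb : Set.Ioo 0 c ⊆ E := by
    intro s hs
    have hs' : s ∈ Set.Ioo (0 : ℝ) 1 := ⟨hs.1, hs.2.trans_le hc1⟩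
    refine ⟨hs', ?_⟩
    obtain ⟨u, hu, rfl⟩ := exists_mem_core (μ := μ) hs'
    rw [meanQuantile_cdf hQ n hu]
    by_contra! hlt
    refine absurd hs.2 (not_lt.2 ?_)
    rw [hcr, cdf_eq_real]
    refine ENNReal.toReal_mono (measure_ne_top _ _) (measure_mono_ae ?_)
    filter_upwards [hae] with w hw hwx
    refine le_of_not_gt fun h => ?_
    have h1 := hmono hu.1 hw.1 h
    have h2 : meanMap T n w ≤ x := hwx
    linarith
  change sSup E = c
  -- For `c = 0` the set is empty, and the convention `sSup ∅ = 0` gives the right value.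
  rcases hc0.eq_or_lt with h0 | h0
  · rw [Set.subset_eq_empty hub (by simp [← h0]), Real.sSup_empty, h0]
  · refine le_antisymm (csSup_le ((Set.nonempty_Ioo.2 h0).mono hlb) fun s hs => (hub hs).2) ?_
    rw [← csSup_Ioo h0]
    exact csSup_le_csSup ⟨c, fun s hs => (hub hs).2⟩ (Set.nonempty_Ioo.2 h0) hlb

lemma meanCdf_meanMap [NullSingletonClass μ] (hS : μ.support.OrdConnected)
    (hQ : ∀ t, ∀ u ∈ core μ, Q t (cdf μ u) = T t u) (n : ℕ)
    (hm : Measurable (meanMap T n)) (hmono : StrictMonoOn (meanMap T n) μ.support) {u : ℝ}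
    (hu : u ∈ core μ) : meanCdf Q n (meanMap T n u) = cdf μ u := by
  rw [meanCdf_eq_cdf_map hS hQ n hm hmono, cdf_map_apply hm, cdf_eq_real]
  refine congrArg ENNReal.toReal (measure_congr ?_)
  filter_upwards [ae_mem_core hS] with w hw
  exact propext (hmono.le_iff_le hw.1 hu.1)

/-- By the area formula the integral of `|R'|` over `A = R⁻¹(N) ∩ supp μ` is the measure of `R(A) ⊆
N`, which is zero; as `R' > 0` on `A`, the set `A` itself is null. -/
lemma map_absolutelyContinuous_of_derivWithin_pos (hμ : μ ≪ volume) {R : ℝ → ℝ}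
    (hR : Measurable R) (hd : ∀ u ∈ μ.support, DifferentiableWithinAt ℝ R μ.support u)
    (hpos : ∀ u ∈ μ.support, 0 < derivWithin R μ.support u) (hinj : Set.InjOn R μ.support) :
    μ.map R ≪ volume := by
  refine Measure.AbsolutelyContinuous.mk fun N hN hN0 => ?_
  rw [Measure.map_apply hR hN]
  set A := R ⁻¹' N ∩ μ.support with hA
  have hSm : MeasurableSet μ.support := Measure.isClosed_support.measurableSet
  have hAm : MeasurableSet A := (hR hN).inter hSm
  have hle : μ (R ⁻¹' N) ≤ μ A := by
    refine measure_mono_ae ?_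
    filter_upwards [(Measure.support_mem_ae : μ.support ∈ ae μ)] with w hw hw' using ⟨hw', hw⟩
  refine le_antisymm (hle.trans (hμ ?_).le) zero_le
  have key := lintegral_image_eq_lintegral_abs_deriv_mul hAm
    (fun x hx => ((hd x hx.2).hasDerivWithinAt.mono Set.inter_subset_right))
    (hinj.mono Set.inter_subset_right) (fun _ => 1)
  have himg : volume (R '' A) = 0 :=
    measure_mono_null (by rintro _ ⟨w, hw, rfl⟩; exact hw.1) hN0
  simp only [lintegral_const, one_mul, Measure.restrict_apply_univ, himg, mul_one] at key
  have hmeas : AEMeasurable (fun x => derivWithin R μ.support x) (volume.restrict A) :=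
    AEMeasurable.apply_continuousLinearMap (aemeasurable_fderivWithin volume hAm fun x hx =>
      ((hd x hx.2).hasFDerivWithinAt.mono Set.inter_subset_right)) 1
  have hz := (lintegral_eq_zero_iff' (by fun_prop)).1 key.symm
  rw [EventuallyEq, ae_restrict_iff' hAm] at hz
  refine measure_mono_null (fun x hx => ?_) (ae_iff.1 hz)
  simp [hx, (hpos x hx.2).ne']

/-- Lebesgue differentiation: the derivative of the distribution function is almost everywhere the
density. No integrability of `g` is needed. -/
lemma integral_mul_deriv_cdf {ν : Measure ℝ} [IsProbabilityMeasure ν] (hν : ν ≪ volume)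
    (g : ℝ → ℝ) : ∫ x, g x * deriv (cdf ν) x = ∫ x, g x ∂ν := by
  rw [← integral_rnDeriv_smul hν]
  refine integral_congr_ae ?_
  filter_upwards [(cdf ν).ae_hasDerivAt] with x hx
  rw [hx.deriv, measure_cdf, smul_eq_mul, mul_comm]

/-- The substitution `x = M u`, with `M` the mean map: `F̂ (M u) = F u` turns `T̂_t (M u)` into `T_t
u`, and `f̂(x) dx` is the image of `μ` under `M`. -/
lemma integral_estAutocov [NullSingletonClass μ] (hμ : μ ≪ volume) (hS : μ.support.OrdConnected)
    (hQ : ∀ t, ∀ u ∈ core μ, Q t (cdf μ u) = T t u)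
    (hTm : ∀ t, StrictMonoOn (T t) μ.support) (n : ℕ)
    (hm : Measurable (meanMap T n)) (hmono : StrictMonoOn (meanMap T n) μ.support)
    (hd : ∀ u ∈ μ.support, DifferentiableWithinAt ℝ (meanMap T n) μ.support u)
    (hpos : ∀ u ∈ μ.support, 0 < derivWithin (meanMap T n) μ.support u) (h : ℕ) :
    ∫ u, estAutocov Q n h u * meanDens Q n u =
      ∫ u, (n : ℝ)⁻¹ * ∑ t ∈ Finset.Icc (1 : ℤ) ((n : ℤ) - h),
        (T t u - meanMap T n u) * (T (t + h) u - meanMap T n u) ∂μ := by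
  set ν := μ.map (meanMap T n) with hν
  have : IsProbabilityMeasure ν := Measure.isProbabilityMeasure_map hm.aemeasurable
  have hfun : meanCdf Q n = cdf ν := funext fun x => meanCdf_eq_cdf_map hS hQ n hm hmono x
  have hac : ν ≪ volume :=
    map_absolutelyContinuous_of_derivWithin_pos hμ hm hd hpos hmono.injOn
  have hcore := ae_mem_core hS
  have hcν : Measurable (cdf ν) := (cdf ν).mono.measurable
  -- The change of variables needs measurability of `Q t ∘ F̂`. It comes from monotonicity of `Q t`
  -- on `(0, 1)`, where `F̂` takes its values almost surely under `ν`.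
  have hQmono : ∀ t, MonotoneOn (Q t) (Set.Ioo 0 1) := by
    intro t s hs s' hs' hss
    obtain ⟨u, hu, rfl⟩ := exists_mem_core (μ := μ) hs
    obtain ⟨u', hu', rfl⟩ := exists_mem_core (μ := μ) hs'
    rw [hQ t u hu, hQ t u' hu']
    exact (hTm t).monotoneOn hu.1 hu'.1 (((cdf_strictMonoOn_support hS).le_iff_le hu.1 hu'.1).1 hss)
  have hconc : ∀ᵐ x ∂ν, cdf ν x ∈ Set.Ioo (0 : ℝ) 1 := by
    rw [hν, ae_map_iff hm.aemeasurable (hcν measurableSet_Ioo)]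
    filter_upwards [hcore] with u hu
    rw [← hfun, meanCdf_meanMap hS hQ n hm hmono hu]
    exact hu.2
  have hQae : ∀ t, AEMeasurable (estTransport Q n t) ν := by
    intro t
    have h1 : AEMeasurable (Q t) ((ν.map (cdf ν)).restrict (Set.Ioo 0 1)) :=
      aemeasurable_restrict_of_monotoneOn measurableSet_Ioo (hQmono t)
    have h2 : ∀ᵐ s ∂(ν.map (cdf ν)), s ∈ Set.Ioo (0 : ℝ) 1 :=
      (ae_map_iff hcν.aemeasurable measurableSet_Ioo).2 hconc
    rw [Measure.restrict_eq_self_of_ae_mem h2] at h1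
    have := h1.comp_measurable hcν
    rwa [← hfun] at this
  have hg : AEMeasurable (estAutocov Q n h) ν := by
    unfold estAutocov
    refine AEMeasurable.const_mul ?_ _
    refine Finset.aemeasurable_fun_sum _ fun t _ => ?_
    exact ((hQae t).sub aemeasurable_id).mul ((hQae _).sub aemeasurable_id)
  have hdens : meanDens Q n = deriv (cdf ν) := by
    funext x
    rw [meanDens, hfun]
  rw [hdens, integral_mul_deriv_cdf hac, hν, integral_map hm.aemeasurable hg.aestronglyMeasurable]
  refine integral_congr_ae ?_
  filter_upwards [hcore] with u hu
  simp only [estAutocov, estTransport, meanCdf_meanMap hS hQ n hm hmono hu, hQ _ u hu]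

lemma meanMap_add_id (v : ℤ → ℝ → ℝ) {n : ℕ} (hn : n ≠ 0) :
    meanMap (fun t u => v t u + u) n = fun u => meanMap v n u + u := by
  funext u
  have : (n : ℝ) ≠ 0 := by exact_mod_cast hn
  simp [meanMap, Finset.sum_add_distrib, mul_add, this]

lemma integral_estAutocov_quantile_expMap (hμ : μ ≪ volume) (hS : μ.support.OrdConnected)
    {v : ℤ → ℝ → ℝ} (hv : ∀ t, Measurable (v t))
    (hd : ∀ t, ∀ u ∈ μ.support, DifferentiableWithinAt ℝ (v t) μ.support u ∧
      -1 < derivWithin (v t) μ.support u) {n : ℕ} (hn : n ≠ 0) (h : ℕ) :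
    ∫ u, estAutocov (fun t => quantile (expMap μ (v t))) n h u *
        meanDens (fun t => quantile (expMap μ (v t))) n u =
      ∫ u, (n : ℝ)⁻¹ * ∑ t ∈ Finset.Icc (1 : ℤ) ((n : ℤ) - h),
        (v t u - meanMap v n u) * (v (t + h) u - meanMap v n u) ∂μ := by
  have : NullSingletonClass μ := ⟨fun x => hμ (measure_singleton x)⟩
  have hn' : (n : ℝ) ≠ 0 := by exact_mod_cast hn
  have hconv : Convex ℝ μ.support := hS.convex
  -- Derivatives within the support are unique because it is convex with nonempty interior: it
  -- contains an interval between points at two different levels of the distribution function.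
  have hud : ∀ u ∈ μ.support, UniqueDiffWithinAt ℝ μ.support u := by
    refine uniqueDiffOn_convex hconv ?_
    obtain ⟨a, ha, ha'⟩ := exists_mem_core (μ := μ) (s := 1 / 3) (by norm_num)
    obtain ⟨b, hb, hb'⟩ := exists_mem_core (μ := μ) (s := 2 / 3) (by norm_num)
    have hab : a < b := by
      refine lt_of_not_ge fun hba => ?_
      have := (cdf μ).mono hba
      rw [ha', hb'] at this
      norm_num at this
    have : Set.Ioo a b ⊆ interior μ.support :=
      interior_maximal (fun x hx => hS.out ha.1 hb.1 ⟨hx.1.le, hx.2.le⟩) isOpen_Ioo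
    exact (Set.nonempty_Ioo.2 hab).mono this
  have hstrict : ∀ R : ℝ → ℝ, (∀ u ∈ μ.support, DifferentiableWithinAt ℝ R μ.support u) →
      (∀ u ∈ μ.support, 0 < derivWithin R μ.support u) → StrictMonoOn R μ.support := by
    intro R h1 h2
    refine strictMonoOn_of_deriv_pos hconv (fun u hu => (h1 u hu).continuousWithinAt) ?_
    intro x hx
    rw [← derivWithin_of_mem_nhds (mem_interior_iff_mem_nhds.1 hx)]
    exact h2 x (interior_subset hx)
  have hadd : ∀ w : ℝ → ℝ, ∀ c : ℝ, ∀ u ∈ μ.support,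
      HasDerivWithinAt w c μ.support u →
      HasDerivWithinAt (fun u => w u + u) (c + 1) μ.support u := fun w c u _ hw =>
    hw.add (hasDerivWithinAt_id u _)
  have hTd : ∀ t, ∀ u ∈ μ.support, HasDerivWithinAt (fun u => v t u + u)
      (derivWithin (v t) μ.support u + 1) μ.support u := fun t u hu =>
    hadd _ _ u hu (hd t u hu).1.hasDerivWithinAt
  have hTs : ∀ t, StrictMonoOn (fun u => v t u + u) μ.support := fun t =>
    hstrict _ (fun u hu => (hTd t u hu).differentiableWithinAt) fun u hu => by
      rw [(hTd t u hu).derivWithin (hud u hu)]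
      linarith [(hd t u hu).2]
  have hMd : ∀ u ∈ μ.support, HasDerivWithinAt (meanMap (fun t u => v t u + u) n)
      ((n : ℝ)⁻¹ * ∑ t ∈ Finset.Icc (1 : ℤ) n, (derivWithin (v t) μ.support u + 1))
      μ.support u := by
    intro u hu
    exact (HasDerivWithinAt.fun_sum fun t _ => hTd t u hu).const_mul _
  have hMpos : ∀ u ∈ μ.support, 0 < derivWithin (meanMap (fun t u => v t u + u) n) μ.support u := by
    intro u hu
    rw [(hMd u hu).derivWithin (hud u hu)]
    refine mul_pos (by positivity) (Finset.sum_pos (fun t _ => by linarith [(hd t u hu).2]) ?_)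
    exact Finset.nonempty_Icc.2 (by omega)
  have hMm : Measurable (meanMap (fun t u => v t u + u) n) := by
    unfold meanMap
    fun_prop
  rw [integral_estAutocov hμ hS (Q := fun t => quantile (expMap μ (v t)))
    (T := fun t u => v t u + u)
    (fun t u hu => quantile_map_cdf hS ((hv t).add measurable_id)
      (fun w hw => (hTd t w hw).continuousWithinAt) (hTs t) hu) hTs n hMm
    (hstrict _ (fun u hu => (hMd u hu).differentiableWithinAt) hMpos)
    (fun u hu => (hMd u hu).differentiableWithinAt) hMpos h, meanMap_add_id v hn]
  simp only [add_sub_add_right_eq_sub]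

end Deterministic

/-! ### A central limit theorem for real martingale differences, by characteristic functions. -/

section ScalarCLT

/-- The constant 4 covers both regimes: the series remainder for `|x| ≤ 1`, and `2 + |x| + x² / 2 ≤
4 |x|³` for `|x| ≥ 1`. -/
lemma norm_cexp_sub_taylor_le (x : ℝ) :
    ‖Complex.exp (Complex.I * x) - 1 - Complex.I * x + (x : ℂ) ^ 2 / 2‖ ≤ 4 * |x| ^ 3 := by
  rcases le_total |x| 1 with h | h
  · have hn : ‖Complex.I * (x : ℂ)‖ = |x| := by simp
    have := Complex.exp_bound (x := Complex.I * x) (by rw [hn]; exact h) (n := 3) (by norm_num)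
    rw [hn] at this
    have h3 : ∑ m ∈ Finset.range 3, (Complex.I * (x : ℂ)) ^ m / (m.factorial : ℂ) =
        1 + Complex.I * x - (x : ℂ) ^ 2 / 2 := by
      simp only [Finset.sum_range_succ, Finset.range_zero, Finset.sum_empty, mul_pow, Complex.I_sq,
        Nat.factorial]
      norm_num
      ring
    rw [h3] at this
    calc _ = ‖Complex.exp (Complex.I * x) - (1 + Complex.I * x - (x : ℂ) ^ 2 / 2)‖ := by
          congr 1; ring
      _ ≤ _ := this
      _ ≤ 4 * |x| ^ 3 := by
          rw [mul_comm]
          refine mul_le_mul_of_nonneg_right ?_ (by positivity)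
          norm_num [Nat.factorial]
  · have h1 : ‖Complex.exp (Complex.I * x)‖ = 1 := Complex.norm_exp_I_mul_ofReal x
    calc _ ≤ ‖Complex.exp (Complex.I * x)‖ + ‖(1 : ℂ)‖ + ‖Complex.I * (x : ℂ)‖
          + ‖(x : ℂ) ^ 2 / 2‖ :=
          (norm_add_le _ _).trans (by gcongr; exact (norm_sub_le _ _).trans (by gcongr; exact norm_sub_le _ _))
      _ = 2 + |x| + |x| ^ 2 / 2 := by
          rw [h1]; simp; norm_num
      _ ≤ 4 * |x| ^ 3 := by nlinarith [mul_nonneg (sub_nonneg.2 h) (sq_nonneg |x|), mul_nonneg (sub_nonneg.2 h) (abs_nonneg x)]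

lemma abs_exp_neg_sub_le {y : ℝ} (hy : 0 ≤ y) : |Real.exp (-y) - 1 + y| ≤ y ^ 2 := by
  rcases le_total y 1 with h | h
  · have := Real.norm_exp_sub_one_sub_id_le (x := -y) (by simpa [abs_of_nonneg hy] using h)
    simpa [abs_of_nonneg hy] using this
  · have h1 := Real.add_one_le_exp (-y)
    have h2 : Real.exp (-y) ≤ 1 := Real.exp_le_one_iff.2 (by linarith)
    rw [abs_le]
    constructor <;> nlinarith

variable {Ω : Type*} [MeasurableSpace Ω] {P : Measure Ω} [IsProbabilityMeasure P]

/-- The exponential `exp(i a S_t)` of the partial sum `S_t = ∑_{j < t} X_j`. -/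
def expSum (X : ℕ → Ω → ℝ) (a : ℝ) (t : ℕ) (ω : Ω) : ℂ :=
  Complex.exp (Complex.I * ((a * ∑ j ∈ Finset.range t, X j ω : ℝ) : ℂ))

lemma norm_expSum (X : ℕ → Ω → ℝ) (a : ℝ) (t : ℕ) (ω : Ω) : ‖expSum X a t ω‖ = 1 :=
  Complex.norm_exp_I_mul_ofReal _

lemma aestronglyMeasurable_expSum {X : ℕ → Ω → ℝ} (hX : ∀ t, AEMeasurable (X t) P) (a : ℝ) (t : ℕ) :
    AEStronglyMeasurable (expSum X a t) P := by
  refine AEMeasurable.aestronglyMeasurable ?_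
  unfold expSum
  have : AEMeasurable (fun ω => ∑ j ∈ Finset.range t, X j ω) P :=
    Finset.aemeasurable_fun_sum _ fun j _ => hX j
  fun_prop

lemma integrable_expSum_mul {X : ℕ → Ω → ℝ} (hX : ∀ t, AEMeasurable (X t) P) (a : ℝ) (t : ℕ)
    {g : Ω → ℂ} (hg : Integrable g P) : Integrable (fun ω => expSum X a t ω * g ω) P :=
  hg.bdd_mul (aestronglyMeasurable_expSum hX a t) (c := 1)
    (ae_of_all _ fun ω => (norm_expSum X a t ω).le)

lemma norm_expSum_sub_le (X : ℕ → Ω → ℝ) (a : ℝ) {k t : ℕ} (hkt : k ≤ t) (ω : Ω) :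
    ‖expSum X a t ω - expSum X a k ω‖ ≤ |a| * ∑ j ∈ Finset.Ico k t, |X j ω| := by
  have hfac : expSum X a t ω = expSum X a k ω *
      Complex.exp (Complex.I * ((a * ∑ j ∈ Finset.Ico k t, X j ω : ℝ) : ℂ)) := by
    rw [expSum, expSum, ← Complex.exp_add, ← Finset.sum_range_add_sum_Ico _ hkt]
    congr 1
    push_cast
    ring
  calc _ = ‖expSum X a k ω * (Complex.exp (Complex.I *
        ((a * ∑ j ∈ Finset.Ico k t, X j ω : ℝ) : ℂ)) - 1)‖ := by rw [hfac]; congr 1; ring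
    _ ≤ ‖a * ∑ j ∈ Finset.Ico k t, X j ω‖ := by
        rw [norm_mul, norm_expSum, one_mul]
        exact Real.norm_exp_I_mul_ofReal_sub_one_le
    _ ≤ _ := by
        rw [Real.norm_eq_abs, abs_mul]
        gcongr
        exact Finset.abs_sum_le_sum_abs _ _

/-- The two conditions on a sequence of random variables with bounded third moments which yield a
central limit theorem: a martingale difference property, and asymptotic decorrelation of the squares
from the remote past, both tested against exponentials of the partial sums. -/
structure IsMixingDifference (P : Measure Ω) (X : ℕ → Ω → ℝ) (s K : ℝ) : Prop where
  memLp : ∀ t, MemLp (X t) 3 P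
  moment_le : ∀ t, ∫ ω, |X t ω| ^ 3 ∂P ≤ K
  integral_expSum_mul : ∀ a t, ∫ ω, expSum X a t ω * (X t ω : ℂ) ∂P = 0
  decorrelation : ∀ δ > 0, ∃ m : ℕ, ∀ a t,
    ‖∫ ω, expSum X a (t - m) ω * ((X t ω ^ 2 - s : ℝ) : ℂ) ∂P‖ ≤ δ

namespace IsMixingDifference

variable {X : ℕ → Ω → ℝ} {s K : ℝ}

lemma integrable_cube (h : IsMixingDifference P X s K) (t : ℕ) :
    Integrable (fun ω => |X t ω| ^ 3) P := by
  simpa using (h.memLp t).integrable_norm_pow (p := 3) (by norm_num)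

lemma integrable_sq (h : IsMixingDifference P X s K) (t : ℕ) :
    Integrable (fun ω => X t ω ^ 2) P :=
  ((h.memLp t).mono_exponent (by norm_num)).integrable_sq

lemma integrable (h : IsMixingDifference P X s K) (t : ℕ) : Integrable (X t) P :=
  (h.memLp t).integrable (by norm_num)

lemma aemeasurable (h : IsMixingDifference P X s K) (t : ℕ) : AEMeasurable (X t) P :=
  (h.memLp t).aestronglyMeasurable.aemeasurable

lemma bound_nonneg (h : IsMixingDifference P X s K) : 0 ≤ K :=
  (integral_nonneg fun _ => by positivity).trans (h.moment_le 0)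

/-- Moving the exponential back by `m` steps changes it by at most `|a|` times a sum of at most `m`
terms `|X_j|`; third moments bound each `E(|X_j| |X_t² - s|)`. -/
lemma norm_integral_expSum_sub_le (h : IsMixingDifference P X s K) (hs : 0 ≤ s) (a : ℝ)
    {t m : ℕ} :
    ‖(∫ ω, expSum X a t ω * ((X t ω ^ 2 - s : ℝ) : ℂ) ∂P) -
      ∫ ω, expSum X a (t - m) ω * ((X t ω ^ 2 - s : ℝ) : ℂ) ∂P‖ ≤
      |a| * (m * (2 * K + s * (1 + K))) := by
  have hK := h.bound_nonneg
  have hY : Integrable (fun ω => ((X t ω ^ 2 - s : ℝ) : ℂ)) P :=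
    ((h.integrable_sq t).sub (integrable_const s)).ofReal
  rw [← integral_sub (integrable_expSum_mul h.aemeasurable a t hY)
    (integrable_expSum_mul h.aemeasurable a (t - m) hY)]
  have hpt : ∀ x y : ℝ, |x| * |y ^ 2 - s| ≤ |x| ^ 3 + |y| ^ 3 + s * (1 + |x| ^ 3) := by
    intro x y
    have h1 : |y ^ 2 - s| ≤ |y| ^ 2 + s := by
      rw [← sq_abs]
      exact (abs_sub _ _).trans (by rw [abs_of_nonneg hs, abs_of_nonneg (by positivity)])
    have h2 : |x| * |y| ^ 2 ≤ |x| ^ 3 + |y| ^ 3 := by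
      have hx := abs_nonneg x
      have hy := abs_nonneg y
      rcases le_total |x| |y| with hxy | hxy
      · nlinarith [mul_le_mul_of_nonneg_right hxy (sq_nonneg |y|), pow_nonneg hx 3]
      · nlinarith [mul_le_mul_of_nonneg_left (pow_le_pow_left₀ hy hxy 2) hx, pow_nonneg hy 3]
    have h3 : |x| ≤ 1 + |x| ^ 3 := by
      have hx := abs_nonneg x
      rcases le_total |x| 1 with hx1 | hx1
      · nlinarith [pow_nonneg hx 3]
      · nlinarith [mul_nonneg (sub_nonneg.2 hx1) hx, mul_nonneg (sub_nonneg.2 hx1) (sq_nonneg |x|)]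
    calc |x| * |y ^ 2 - s| ≤ |x| * (|y| ^ 2 + s) := by gcongr
      _ = |x| * |y| ^ 2 + s * |x| := by ring
      _ ≤ _ := by gcongr
  have hG : ∀ j, Integrable (fun ω => |X j ω| ^ 3 + |X t ω| ^ 3 + s * (1 + |X j ω| ^ 3)) P :=
    fun j => ((h.integrable_cube j).add (h.integrable_cube t)).add
      (((integrable_const 1).add (h.integrable_cube j)).const_mul s)
  have hGi : ∀ j, ∫ ω, (|X j ω| ^ 3 + |X t ω| ^ 3 + s * (1 + |X j ω| ^ 3)) ∂P ≤
      2 * K + s * (1 + K) := by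
    intro j
    have e1 : Integrable (fun ω => |X j ω| ^ 3 + |X t ω| ^ 3) P :=
      (h.integrable_cube j).add (h.integrable_cube t)
    have e2 : Integrable (fun ω => 1 + |X j ω| ^ 3) P :=
      (integrable_const 1).add (h.integrable_cube j)
    rw [integral_add e1 (e2.const_mul s),
      integral_add (h.integrable_cube j) (h.integrable_cube t), integral_const_mul,
      integral_add (integrable_const 1) (h.integrable_cube j)]
    simp only [integral_const, probReal_univ, smul_eq_mul, one_mul]
    have h1 := h.moment_le j
    have h2 := h.moment_le t
    nlinarith [mul_le_mul_of_nonneg_left h1 hs]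
  calc _ ≤ ∫ ω, |a| * ∑ j ∈ Finset.Ico (t - m) t,
        (|X j ω| ^ 3 + |X t ω| ^ 3 + s * (1 + |X j ω| ^ 3)) ∂P := by
        refine norm_integral_le_of_norm_le
          ((integrable_finsetSum _ fun j _ => hG j).const_mul _) (ae_of_all _ fun ω => ?_)
        rw [← sub_mul, norm_mul, Complex.norm_real, Real.norm_eq_abs]
        refine (mul_le_mul_of_nonneg_right (norm_expSum_sub_le X a (Nat.sub_le t m) ω)
          (abs_nonneg _)).trans ?_
        rw [mul_assoc, Finset.sum_mul]
        gcongr with j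
        exact hpt _ _
    _ = |a| * ∑ j ∈ Finset.Ico (t - m) t,
        ∫ ω, (|X j ω| ^ 3 + |X t ω| ^ 3 + s * (1 + |X j ω| ^ 3)) ∂P := by
        rw [integral_const_mul, integral_finsetSum _ fun j _ => hG j]
    _ ≤ |a| * ∑ j ∈ Finset.Ico (t - m) t, (2 * K + s * (1 + K)) := by
        gcongr with j
        exact hGi j
    _ ≤ _ := by
        rw [Finset.sum_const, Nat.card_Ico, nsmul_eq_mul]
        gcongr
        omega

/-- Second-order Taylor expansion of `exp(i a X_t)`: the linear term integrates to zero, and `X_t²`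
is replaced by `s` at the price of the decorrelation bound. For `a = θ / √n` the error is `a² δ / 2
+ O(n^{-3/2})` for fixed `m`, so `n` steps cost `O(δ) + O(n^{-1/2})`. -/
lemma norm_integral_expSum_succ_sub_le (h : IsMixingDifference P X s K) (hs : 0 ≤ s) {δ : ℝ}
    {m : ℕ} (hm : ∀ a t, ‖∫ ω, expSum X a (t - m) ω * ((X t ω ^ 2 - s : ℝ) : ℂ) ∂P‖ ≤ δ)
    (a : ℝ) (t : ℕ) :
    ‖(∫ ω, expSum X a (t + 1) ω ∂P) -
      (Real.exp (-(a ^ 2 * s / 2)) : ℂ) * ∫ ω, expSum X a t ω ∂P‖ ≤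
      a ^ 2 / 2 * (δ + |a| * (m * (2 * K + s * (1 + K)))) + 4 * (|a| ^ 3 * K)
        + (a ^ 2 * s / 2) ^ 2 := by
  set p := Real.exp (-(a ^ 2 * s / 2)) with hp
  set R : ℝ → ℂ := fun x => Complex.exp (Complex.I * x) - 1 - Complex.I * x + (x : ℂ) ^ 2 / 2
    with hR
  have hXm := h.aemeasurable
  have hY : Integrable (fun ω => ((X t ω ^ 2 - s : ℝ) : ℂ)) P :=
    ((h.integrable_sq t).sub (integrable_const s)).ofReal
  have hX : Integrable (fun ω => (X t ω : ℂ)) P := (h.integrable t).ofReal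
  have hRi : Integrable (fun ω => R (a * X t ω)) P := by
    refine Integrable.mono' (((h.integrable_cube t).const_mul (|a| ^ 3)).const_mul 4) ?_
      (ae_of_all _ fun ω => (norm_cexp_sub_taylor_le _).trans_eq ?_)
    · refine AEMeasurable.aestronglyMeasurable ?_
      have := hXm t
      simp only [hR]
      fun_prop
    · rw [abs_mul, mul_pow]
  have hsplit : ∀ ω, expSum X a (t + 1) ω - p * expSum X a t ω =
      Complex.I * a * (expSum X a t ω * (X t ω : ℂ))
      - (a : ℂ) ^ 2 / 2 * (expSum X a t ω * ((X t ω ^ 2 - s : ℝ) : ℂ))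
      + expSum X a t ω * R (a * X t ω)
      - ((p - 1 + a ^ 2 * s / 2 : ℝ) : ℂ) * expSum X a t ω := by
    intro ω
    have : expSum X a (t + 1) ω = expSum X a t ω *
        Complex.exp (Complex.I * ((a * X t ω : ℝ) : ℂ)) := by
      rw [expSum, expSum, ← Complex.exp_add, Finset.sum_range_succ]
      congr 1
      push_cast
      ring
    rw [this]
    simp only [hR]
    push_cast
    ring
  have hE : ∀ k, Integrable (expSum X a k) P := fun k => by
    simpa using integrable_expSum_mul hXm a k (g := fun _ => 1) (integrable_const 1)
  have i1 := (integrable_expSum_mul hXm a t hX).const_mul (Complex.I * a)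
  have i2 := (integrable_expSum_mul hXm a t hY).const_mul ((a : ℂ) ^ 2 / 2)
  have i3 := integrable_expSum_mul hXm a t hRi
  have i4 := (hE t).const_mul ((p - 1 + a ^ 2 * s / 2 : ℝ) : ℂ)
  have i12 : Integrable (fun ω => Complex.I * a * (expSum X a t ω * (X t ω : ℂ))
      - (a : ℂ) ^ 2 / 2 * (expSum X a t ω * ((X t ω ^ 2 - s : ℝ) : ℂ))) P := i1.sub i2
  have i123 : Integrable (fun ω => Complex.I * a * (expSum X a t ω * (X t ω : ℂ))
      - (a : ℂ) ^ 2 / 2 * (expSum X a t ω * ((X t ω ^ 2 - s : ℝ) : ℂ))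
      + expSum X a t ω * R (a * X t ω)) P := i12.add i3
  rw [← integral_const_mul, ← integral_sub (hE (t + 1)) ((hE t).const_mul _),
    integral_congr_ae (ae_of_all _ hsplit), integral_sub i123 i4,
    integral_add i12 i3, integral_sub i1 i2, integral_const_mul, integral_const_mul,
    integral_const_mul, h.integral_expSum_mul a t, mul_zero, zero_sub]
  have b2 : ‖∫ ω, expSum X a t ω * ((X t ω ^ 2 - s : ℝ) : ℂ) ∂P‖ ≤
      δ + |a| * (m * (2 * K + s * (1 + K))) := by
    have := h.norm_integral_expSum_sub_le hs a (t := t) (m := m)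
    calc _ = ‖(∫ ω, expSum X a (t - m) ω * ((X t ω ^ 2 - s : ℝ) : ℂ) ∂P) +
          ((∫ ω, expSum X a t ω * ((X t ω ^ 2 - s : ℝ) : ℂ) ∂P) -
            ∫ ω, expSum X a (t - m) ω * ((X t ω ^ 2 - s : ℝ) : ℂ) ∂P)‖ := by
          rw [add_sub_cancel]
      _ ≤ _ := (norm_add_le _ _).trans (add_le_add (hm a t) this)
  have b3 : ‖∫ ω, expSum X a t ω * R (a * X t ω) ∂P‖ ≤ 4 * (|a| ^ 3 * K) := by
    calc _ ≤ ∫ ω, 4 * (|a| ^ 3 * |X t ω| ^ 3) ∂P := by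
          refine norm_integral_le_of_norm_le
            (((h.integrable_cube t).const_mul (|a| ^ 3)).const_mul 4) (ae_of_all _ fun ω => ?_)
          rw [norm_mul, norm_expSum, one_mul, ← mul_pow, ← abs_mul]
          exact norm_cexp_sub_taylor_le _
      _ ≤ _ := by
          rw [integral_const_mul, integral_const_mul]
          gcongr
          exact h.moment_le t
  have b4 : ‖∫ ω, expSum X a t ω ∂P‖ ≤ 1 := by
    refine (norm_integral_le_of_norm_le (integrable_const (1 : ℝ))
      (ae_of_all _ fun ω => (norm_expSum X a t ω).le)).trans ?_
    simp
  have b5 : |p - 1 + a ^ 2 * s / 2| ≤ (a ^ 2 * s / 2) ^ 2 := abs_exp_neg_sub_le (by positivity)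
  refine (norm_sub_le _ _).trans (add_le_add ((norm_add_le _ _).trans (add_le_add ?_ b3)) ?_)
  · rw [norm_neg, norm_mul]
    have : ‖(a : ℂ) ^ 2 / 2‖ = a ^ 2 / 2 := by simp
    rw [this]
    gcongr
  · rw [norm_mul, Complex.norm_real, Real.norm_eq_abs]
    calc _ ≤ (a ^ 2 * s / 2) ^ 2 * 1 := by gcongr
      _ = _ := mul_one _

/-- A factor of norm at most one does not amplify errors, so they only add up. -/
lemma norm_sub_pow_le_of_norm_succ_sub_le {u : ℕ → ℂ} {p : ℂ} {e : ℝ} (hp : ‖p‖ ≤ 1) (h0 : u 0 = 1)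
    (h : ∀ t, ‖u (t + 1) - p * u t‖ ≤ e) (n : ℕ) : ‖u n - p ^ n‖ ≤ n * e := by
  induction n with
  | zero => simp [h0]
  | succ n ih =>
    calc ‖u (n + 1) - p ^ (n + 1)‖ = ‖(u (n + 1) - p * u n) + p * (u n - p ^ n)‖ := by
          congr 1; ring
      _ ≤ e + 1 * (n * e) := (norm_add_le _ _).trans (add_le_add (h n) (by rw [norm_mul]; gcongr))
      _ = _ := by push_cast; ring

lemma tendsto_integral_expSum (h : IsMixingDifference P X s K) (hs : 0 ≤ s) (θ : ℝ) :
    Tendsto (fun n : ℕ => ∫ ω, expSum X (θ / √n) n ω ∂P) atTop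
      (𝓝 (Real.exp (-(θ ^ 2 * s / 2)) : ℂ)) := by
  rw [Metric.tendsto_atTop']
  intro η hη
  -- With this `δ` the non-vanishing part `θ² δ / 2` of the accumulated error stays below `η`; `m`
  -- is then fixed while `n` grows.
  obtain ⟨m, hm⟩ := h.decorrelation (η / (θ ^ 2 + 1)) (by positivity)
  set C := 2 * K + s * (1 + K) with hC
  have hlim : Tendsto (fun n : ℕ => θ ^ 2 / 2 * (η / (θ ^ 2 + 1)) +
      (θ ^ 2 / 2 * |θ| * (m * C) + 4 * (|θ| ^ 3 * K)) * (√n)⁻¹ +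
      (θ ^ 2 * s / 2) ^ 2 * (n : ℝ)⁻¹) atTop
      (𝓝 (θ ^ 2 / 2 * (η / (θ ^ 2 + 1)) + (θ ^ 2 / 2 * |θ| * (m * C) + 4 * (|θ| ^ 3 * K)) * 0 +
        (θ ^ 2 * s / 2) ^ 2 * 0)) := by
    have h1 : Tendsto (fun n : ℕ => (√n)⁻¹) atTop (𝓝 0) :=
      tendsto_inv_atTop_zero.comp (Real.tendsto_sqrt_atTop.comp tendsto_natCast_atTop_atTop)
    have h2 : Tendsto (fun n : ℕ => (n : ℝ)⁻¹) atTop (𝓝 0) :=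
      tendsto_inv_atTop_zero.comp tendsto_natCast_atTop_atTop
    exact (tendsto_const_nhds.add (h1.const_mul _)).add (h2.const_mul _)
  have hlt : θ ^ 2 / 2 * (η / (θ ^ 2 + 1)) + (θ ^ 2 / 2 * |θ| * (m * C) + 4 * (|θ| ^ 3 * K)) * 0 +
        (θ ^ 2 * s / 2) ^ 2 * 0 < η := by
    simp only [mul_zero, add_zero]
    rw [← mul_div_assoc, div_lt_iff₀ (by positivity)]
    nlinarith [sq_nonneg θ]
  obtain ⟨N, hN⟩ := eventually_atTop.1 (hlim.eventually_lt_const hlt)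
  refine ⟨N, fun n hn => ?_⟩
  rw [dist_eq_norm]
  refine lt_of_le_of_lt ?_ (hN n hn.le)
  have hn0 : (0 : ℝ) < n := by exact_mod_cast (Nat.zero_le N).trans_lt hn
  set a := θ / √n with ha
  have ha2 : a ^ 2 = θ ^ 2 / n := by rw [ha, div_pow, Real.sq_sqrt hn0.le]
  have hstep := norm_sub_pow_le_of_norm_succ_sub_le
    (u := fun t => ∫ ω, expSum X a t ω ∂P) (p := (Real.exp (-(a ^ 2 * s / 2)) : ℂ))
    (by rw [Complex.norm_real, Real.norm_eq_abs, abs_of_pos (Real.exp_pos _)]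
        exact Real.exp_le_one_iff.2 (by rw [neg_nonpos]; positivity))
    (by simp [expSum]) (h.norm_integral_expSum_succ_sub_le hs hm a) n
  have hpow : (Real.exp (-(a ^ 2 * s / 2)) : ℂ) ^ n = (Real.exp (-(θ ^ 2 * s / 2)) : ℂ) := by
    rw [← Complex.ofReal_pow, ← Real.exp_nat_mul, ha2]
    congr 3
    field_simp
  rw [hpow] at hstep
  refine hstep.trans_eq ?_
  have habs : |a| = |θ| * (√n)⁻¹ := by
    rw [ha, abs_div, abs_of_nonneg (Real.sqrt_nonneg _), div_eq_mul_inv]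
  have ha3 : |a| ^ 3 = a ^ 2 * |a| := by rw [← sq_abs]; ring
  have ht3 : |θ| ^ 3 = θ ^ 2 * |θ| := by rw [← sq_abs]; ring
  rw [ha3, ht3, habs, ha2, hC]
  field_simp
  ring

theorem tendstoInDistribution (h : IsMixingDifference P X s K) (hs : 0 ≤ s) :
    TendstoInDistribution (fun (n : ℕ) ω => (√n)⁻¹ * ∑ t ∈ Finset.range n, X t ω) atTop
      (id : ℝ → ℝ) (fun _ => P) (gaussianReal 0 s.toNNReal) where
  forall_aemeasurable n := .const_mul (Finset.aemeasurable_fun_sum _ fun t _ => h.aemeasurable t) _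
  aemeasurable_limit := aemeasurable_id
  tendsto := by
    refine ProbabilityMeasure.tendsto_iff_tendsto_charFun.2 fun θ => ?_
    have h1 := h.tendsto_integral_expSum hs θ
    have h2 : charFun ((gaussianReal 0 s.toNNReal).map id) θ = (Real.exp (-(θ ^ 2 * s / 2)) : ℂ) := by
      rw [Measure.map_id, charFun_gaussianReal]
      push_cast
      rw [Real.coe_toNNReal _ hs]
      congr 1
      simp
      ring
    simp only [ProbabilityMeasure.coe_mk]
    rw [h2]
    refine h1.congr fun n => ?_
    have hm : AEMeasurable (fun ω => (√n)⁻¹ * ∑ t ∈ Finset.range n, X t ω) P :=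
      .const_mul (Finset.aemeasurable_fun_sum _ fun t _ => h.aemeasurable t) _
    rw [charFun_apply_real, integral_map hm (by fun_prop)]
    refine integral_congr_ae (ae_of_all _ fun ω => ?_)
    simp only [expSum]
    congr 1
    push_cast
    ring

end IsMixingDifference

end ScalarCLT

/-! ### Causal autoregressions in a Hilbert space and the central limit theorem for their score. -/

section Autoregression

variable {Ω : Type*} {mΩ : MeasurableSpace Ω} {P : Measure Ω}
variable {H : Type*} [NormedAddCommGroup H] [InnerProductSpace ℝ H] [CompleteSpace H]
  [SecondCountableTopology H] [MeasurableSpace H] [BorelSpace H]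

/-- The `σ`-algebra generated by the variables `ε_s`, `s ∈ S`. -/
@[reducible]
def block (ε : ℤ → Ω → H) (S : Set ℤ) : MeasurableSpace Ω :=
  ⨆ s ∈ S, MeasurableSpace.comap (ε s) inferInstance

lemma block_mono (ε : ℤ → Ω → H) {S T : Set ℤ} (h : S ⊆ T) : block ε S ≤ block ε T :=
  biSup_mono h

lemma block_le {ε : ℤ → Ω → H} (hε : ∀ t, Measurable (ε t)) (S : Set ℤ) : block ε S ≤ mΩ :=
  iSup₂_le fun t _ => (hε t).comap_le

lemma measurable_block (ε : ℤ → Ω → H) {S : Set ℤ} {t : ℤ} (ht : t ∈ S) :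
    Measurable[block ε S] (ε t) :=
  Measurable.mono (comap_measurable (ε t))
    (le_iSup₂ (f := fun s (_ : s ∈ S) => MeasurableSpace.comap (ε s) inferInstance) t ht) le_rfl

lemma indepFun_of_block {ε : ℤ → Ω → H} (hε : ∀ t, Measurable (ε t)) (hind : iIndepFun ε P)
    {S T : Set ℤ} (hST : Disjoint S T) {A B : Type*} [MeasurableSpace A] [MeasurableSpace B]
    {f : Ω → A} {g : Ω → B} (hf : Measurable[block ε S] f) (hg : Measurable[block ε T] g) :
    IndepFun f g P := by
  have h := indep_iSup_of_disjoint (fun t => (hε t).comap_le) hind hST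
  rw [IndepFun_iff_Indep]
  exact indep_of_indep_of_le_left (indep_of_indep_of_le_right h hg.comap_le) hf.comap_le

lemma integral_inner_eq_zero {A Y : Ω → H} (h : IndepFun A Y P) (hA : Integrable A P)
    (hY : Integrable Y P) (h0 : ∫ ω, Y ω ∂P = 0) : ∫ ω, inner ℝ (A ω) (Y ω) ∂P = 0 := by
  have := h.integral_bilin hA hY (innerSL ℝ)
  rw [h0, map_zero] at this
  exact this

/-- Independence makes `‖A‖^k ‖B‖^k` integrable, so the scalar product has as many moments as its
factors; Hölder's inequality alone would require twice as many. -/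
lemma memLp_inner_of_indepFun {A B : Ω → H} (h : IndepFun A B P) {k : ℕ} (hk : k ≠ 0)
    (hA : MemLp A k P) (hB : MemLp B k P) :
    MemLp (fun ω => inner ℝ (A ω) (B ω)) k P ∧
      ∫ ω, |inner ℝ (A ω) (B ω)| ^ k ∂P ≤ (∫ ω, ‖A ω‖ ^ k ∂P) * ∫ ω, ‖B ω‖ ^ k ∂P := by
  have hAi := hA.integrable_norm_pow hk
  have hBi := hB.integrable_norm_pow hk
  have hind : IndepFun (fun ω => ‖A ω‖ ^ k) (fun ω => ‖B ω‖ ^ k) P :=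
    h.comp (φ := fun x => ‖x‖ ^ k) (ψ := fun x => ‖x‖ ^ k) (by fun_prop) (by fun_prop)
  have hprod : Integrable (fun ω => ‖A ω‖ ^ k * ‖B ω‖ ^ k) P := hind.integrable_mul hAi hBi
  have hle : ∀ ω, |inner ℝ (A ω) (B ω)| ^ k ≤ ‖A ω‖ ^ k * ‖B ω‖ ^ k := fun ω => by
    rw [← mul_pow]
    exact pow_le_pow_left₀ (abs_nonneg _) (abs_real_inner_le_norm _ _) k
  have hmeas : AEStronglyMeasurable (fun ω => (inner ℝ (A ω) (B ω) : ℝ)) P :=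
    hA.aestronglyMeasurable.inner hB.aestronglyMeasurable
  have hint : Integrable (fun ω => |inner ℝ (A ω) (B ω)| ^ k) P := by
    refine hprod.mono' ?_ (ae_of_all _ fun ω => ?_)
    · exact (hmeas.norm.pow k)
    · rw [Real.norm_eq_abs, abs_of_nonneg (by positivity)]
      exact hle ω
  refine ⟨?_, ?_⟩
  · rw [← integrable_norm_rpow_iff hmeas (by exact_mod_cast hk) (by simp)]
    simpa using hint
  · refine (integral_mono hint hprod hle).trans_eq ?_
    exact hind.integral_mul_eq_mul_integral hAi.aestronglyMeasurable hBi.aestronglyMeasurable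

/-- Iterating the autoregressive equation `m` times. -/
lemma ae_eq_iterate {β : ℝ} {ε V : ℤ → Ω → H}
    (h : ∀ t, ∀ᵐ ω ∂P, V t ω = β • V (t - 1) ω + ε t ω) (t : ℤ) (m : ℕ) :
    ∀ᵐ ω ∂P, V t ω = β ^ m • V (t - m) ω + ∑ j ∈ Finset.range m, β ^ j • ε (t - j) ω := by
  induction m with
  | zero => simp
  | succ m ih =>
    filter_upwards [ih, h (t - m)] with ω h1 h2
    rw [h1, h2, Finset.sum_range_succ, smul_add, smul_smul, ← pow_succ]
    have : t - ((m + 1 : ℕ) : ℤ) = t - m - 1 := by push_cast; ring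
    rw [this]
    abel

/-- A causal solution in `H` of the autoregressive equation `V_t = β V_{t-1} + ε_t`, with
centred iid innovations with finite third moment. -/
structure IsCausalAR (P : Measure Ω) (β : ℝ) (ε V : ℤ → Ω → H) : Prop where
  measurable_noise : ∀ t, Measurable (ε t)
  indep : iIndepFun ε P
  identDistrib_noise : ∀ t, IdentDistrib (ε t) (ε 0) P P
  memLp_noise_zero : MemLp (ε 0) 3 P
  integral_noise_zero : ∫ ω, ε 0 ω ∂P = 0
  measurable_block : ∀ t, Measurable[block ε (Set.Iic t)] (V t)
  identDistrib : ∀ t, IdentDistrib (V t) (V 0) P P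
  memLp_zero : MemLp (V 0) 3 P
  equation : ∀ t, ∀ᵐ ω ∂P, V t ω = β • V (t - 1) ω + ε t ω

/-- The martingale differences `⟨V_t, ε_{t+1}⟩`. -/
def score (ε V : ℤ → Ω → H) (t : ℤ) (ω : Ω) : ℝ := inner ℝ (V t ω) (ε (t + 1) ω)

namespace IsCausalAR

variable {β : ℝ} {ε V : ℤ → Ω → H}

lemma measurable (h : IsCausalAR P β ε V) (t : ℤ) : Measurable (V t) :=
  (h.measurable_block t).mono (block_le h.measurable_noise _) le_rfl

lemma memLp_noise (h : IsCausalAR P β ε V) (t : ℤ) : MemLp (ε t) 3 P :=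
  (h.identDistrib_noise t).memLp_iff.2 h.memLp_noise_zero

lemma memLp (h : IsCausalAR P β ε V) (t : ℤ) : MemLp (V t) 3 P :=
  (h.identDistrib t).memLp_iff.2 h.memLp_zero

lemma integral_noise (h : IsCausalAR P β ε V) (t : ℤ) : ∫ ω, ε t ω ∂P = 0 := by
  rw [(h.identDistrib_noise t).integral_eq, h.integral_noise_zero]

lemma integral_norm_noise_pow (h : IsCausalAR P β ε V) (t : ℤ) (k : ℕ) :
    ∫ ω, ‖ε t ω‖ ^ k ∂P = ∫ ω, ‖ε 0 ω‖ ^ k ∂P :=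
  ((h.identDistrib_noise t).comp (u := fun x => ‖x‖ ^ k) (by fun_prop)).integral_eq

lemma integral_norm_pow (h : IsCausalAR P β ε V) (t : ℤ) (k : ℕ) :
    ∫ ω, ‖V t ω‖ ^ k ∂P = ∫ ω, ‖V 0 ω‖ ^ k ∂P :=
  ((h.identDistrib t).comp (u := fun x => ‖x‖ ^ k) (by fun_prop)).integral_eq

lemma indepFun_future (h : IsCausalAR P β ε V) {s t : ℤ} (hst : s < t) :
    IndepFun (V s) (ε t) P :=
  indepFun_of_block h.measurable_noise h.indep (S := Set.Iic s) (T := {t})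
    (by rw [Set.disjoint_singleton_right]; simpa using hst) (h.measurable_block s)
    (WAR.measurable_block ε rfl)

lemma measurable_score_block (h : IsCausalAR P β ε V) {s t : ℤ} (hst : s < t) :
    Measurable[block ε (Set.Iic t)] (score ε V s) := by
  have h1 := (h.measurable_block s).mono
    (block_mono ε (Set.Iic_subset_Iic.2 hst.le)) le_rfl
  have h2 : Measurable[block ε (Set.Iic t)] (ε (s + 1)) :=
    WAR.measurable_block ε (by simpa using hst)
  exact h1.inner h2

lemma measurable_score (h : IsCausalAR P β ε V) (t : ℤ) : Measurable (score ε V t) :=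
  (h.measurable t).inner (h.measurable_noise (t + 1))

variable [IsProbabilityMeasure P]

lemma memLp_two_noise (h : IsCausalAR P β ε V) (t : ℤ) : MemLp (ε t) 2 P :=
  (h.memLp_noise t).mono_exponent (by norm_num)

lemma memLp_two (h : IsCausalAR P β ε V) (t : ℤ) : MemLp (V t) 2 P :=
  (h.memLp t).mono_exponent (by norm_num)

lemma memLp_score (h : IsCausalAR P β ε V) (t : ℤ) : MemLp (score ε V t) 3 P :=
  (memLp_inner_of_indepFun (h.indepFun_future (lt_add_one t)) (k := 3) (by norm_num)
    (h.memLp t) (h.memLp_noise _)).1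

lemma memLp_two_score (h : IsCausalAR P β ε V) (t : ℤ) : MemLp (score ε V t) 2 P :=
  (h.memLp_score t).mono_exponent (by norm_num)

lemma integral_abs_score_pow_le (h : IsCausalAR P β ε V) (t : ℤ) :
    ∫ ω, |score ε V t ω| ^ 3 ∂P ≤ (∫ ω, ‖V 0 ω‖ ^ 3 ∂P) * ∫ ω, ‖ε 0 ω‖ ^ 3 ∂P := by
  have := (memLp_inner_of_indepFun (h.indepFun_future (lt_add_one t)) (k := 3) (by norm_num)
    (h.memLp t) (h.memLp_noise _)).2
  rwa [h.integral_norm_pow, h.integral_norm_noise_pow] at this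

/-- Scalar products with an independent innovation have a second moment bounded by the product of
the second moments. -/
lemma integral_inner_sq_le (h : IsCausalAR P β ε V) {s t : ℤ} (hst : s < t) :
    ∫ ω, inner ℝ (V s ω) (ε t ω) ^ 2 ∂P ≤ (∫ ω, ‖V 0 ω‖ ^ 2 ∂P) * ∫ ω, ‖ε 0 ω‖ ^ 2 ∂P := by
  have := (memLp_inner_of_indepFun (h.indepFun_future hst) (k := 2) (by norm_num)
    (h.memLp_two s) (h.memLp_two_noise t)).2
  simp only [sq_abs] at this
  rwa [h.integral_norm_pow, h.integral_norm_noise_pow] at this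

/-- The pair `(V_s, ε_t)` is independent with fixed marginals, so its law is the same for all `s <
t`. -/
lemma integral_inner_sq (h : IsCausalAR P β ε V) {s t : ℤ} (hst : s < t) :
    ∫ ω, inner ℝ (V s ω) (ε t ω) ^ 2 ∂P = ∫ ω, score ε V 0 ω ^ 2 ∂P := by
  have h1 : IdentDistrib (fun ω => (V s ω, ε t ω)) (fun ω => (V 0 ω, ε (0 + 1) ω)) P P :=
    (h.identDistrib s).prodMk ((h.identDistrib_noise t).trans (h.identDistrib_noise (0 + 1)).symm)
      (h.indepFun_future hst) (h.indepFun_future (lt_add_one 0))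
  exact (h1.comp (u := fun p : H × H => (inner ℝ p.1 p.2 : ℝ) ^ 2) (by fun_prop)).integral_eq

/-- Bounded weights measurable with respect to the past are orthogonal to the score. -/
lemma integral_mul_score_eq_zero (h : IsCausalAR P β ε V) (t : ℤ) {c : Ω → ℝ}
    (hc : Measurable[block ε (Set.Iic t)] c) (hint : Integrable (fun ω => c ω • V t ω) P) :
    ∫ ω, c ω * score ε V t ω ∂P = 0 := by
  have hind : IndepFun (fun ω => c ω • V t ω) (ε (t + 1)) P :=
    indepFun_of_block h.measurable_noise h.indep (S := Set.Iic t) (T := {t + 1})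
      (by rw [Set.disjoint_singleton_right]; simp)
      (hc.smul (h.measurable_block t)) (WAR.measurable_block ε rfl)
  have := integral_inner_eq_zero hind hint ((h.memLp_noise _).integrable (by norm_num))
    (h.integral_noise _)
  simpa only [real_inner_smul_left, score] using this

/-- The case `t = 0`, an empty sum, is for the natural number `t - m` truncated to zero when the
integer `t - m` is negative. -/
lemma measurable_expSum_block (h : IsCausalAR P β ε V) (a : ℝ) {t : ℕ} {r : ℤ} (htr : t ≤ r ∨ t = 0) :
    Measurable[block ε (Set.Iic r)] (expSum (fun j : ℕ => score ε V j) a t) := by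
  have hsum : Measurable[block ε (Set.Iic r)]
      (fun ω => ∑ j ∈ Finset.range t, score ε V (j : ℤ) ω) := by
    refine Finset.measurable_fun_sum _ fun j hj => h.measurable_score_block ?_
    have := Finset.mem_range.1 hj
    omega
  unfold expSum
  fun_prop

lemma integral_expSum_mul_score (h : IsCausalAR P β ε V) (a : ℝ) (t : ℕ) :
    ∫ ω, expSum (fun j : ℕ => score ε V j) a t ω * (score ε V t ω : ℂ) ∂P = 0 := by
  set φ := expSum (fun j : ℕ => score ε V j) a t with hφ
  have hm : Measurable[block ε (Set.Iic (t : ℤ))] φ := h.measurable_expSum_block a (Or.inl le_rfl)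
  have hm' : Measurable φ := hm.mono (block_le h.measurable_noise _) le_rfl
  have hX : Integrable (fun ω => (score ε V t ω : ℂ)) P :=
    ((h.memLp_score t).integrable (by norm_num)).ofReal
  have hint : Integrable (fun ω => φ ω * (score ε V t ω : ℂ)) P :=
    integrable_expSum_mul (fun j => (h.measurable_score j).aemeasurable) a t hX
  have hVi : Integrable (V t) P := (h.memLp t).integrable (by norm_num)
  have hb : ∀ ω, ‖φ ω‖ = 1 := fun ω => norm_expSum _ a t ω
  -- Real and imaginary parts are bounded real weights depending on the past, to which the
  -- orthogonality of the score applies.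
  have hre : ∫ ω, (φ ω).re * score ε V t ω ∂P = 0 := by
    refine h.integral_mul_score_eq_zero t (Complex.measurable_re.comp hm) ?_
    exact hVi.bdd_smul 1 (Complex.measurable_re.comp hm').aestronglyMeasurable
      (ae_of_all _ fun ω => (Complex.abs_re_le_norm _).trans (hb ω).le)
  have him : ∫ ω, (φ ω).im * score ε V t ω ∂P = 0 := by
    refine h.integral_mul_score_eq_zero t (Complex.measurable_im.comp hm) ?_
    exact hVi.bdd_smul 1 (Complex.measurable_im.comp hm').aestronglyMeasurable
      (ae_of_all _ fun ω => (Complex.abs_im_le_norm _).trans (hb ω).le)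
  apply Complex.ext
  · rw [← RCLike.re_eq_complex_re, ← integral_re hint]
    simpa using hre
  · rw [← RCLike.im_eq_complex_im, ← integral_im hint]
    simpa using him

/-- Writing `V_t = β^m V_r + W` with `r = t - m`, the part `W` depends only on innovations after
time `r`. Hence `Y = ⟨W, ε_{t+1}⟩` is independent of the exponential up to `r`, and `X² - Y²` is of
order `|β|^m` in `L¹`. -/
lemma norm_integral_decorrelation_le (h : IsCausalAR P β ε V) (hβ : |β| < 1) (a : ℝ) (m t : ℕ) :
    ‖∫ ω, expSum (fun j : ℕ => score ε V j) a (t - m) ω *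
        ((score ε V t ω ^ 2 - ∫ ω', score ε V 0 ω' ^ 2 ∂P : ℝ) : ℂ) ∂P‖ ≤
      6 * ((∫ ω, ‖V 0 ω‖ ^ 2 ∂P) * ∫ ω, ‖ε 0 ω‖ ^ 2 ∂P) * |β| ^ m := by
  set s := ∫ ω', score ε V 0 ω' ^ 2 ∂P with hs
  set B := (∫ ω, ‖V 0 ω‖ ^ 2 ∂P) * ∫ ω, ‖ε 0 ω‖ ^ 2 ∂P with hB
  set r : ℤ := (t : ℤ) - m with hr
  set φ := expSum (fun j : ℕ => score ε V j) a (t - m) with hφ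
  set X : Ω → ℝ := score ε V t with hX
  set W : Ω → H := fun ω => ∑ j ∈ Finset.range m, β ^ j • ε ((t : ℤ) - j) ω with hW
  set Y : Ω → ℝ := fun ω => inner ℝ (W ω) (ε ((t : ℤ) + 1) ω) with hY
  set Z : Ω → ℝ := fun ω => inner ℝ (V r ω) (ε ((t : ℤ) + 1) ω) with hZ
  have hrt : r < (t : ℤ) + 1 := by omega
  have hXL : MemLp X 2 P := h.memLp_two_score t
  have hZL : MemLp Z 2 P := (memLp_inner_of_indepFun (h.indepFun_future hrt) (k := 2) (by norm_num)
    (h.memLp_two r) (h.memLp_two_noise _)).1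
  have hXYZ : ∀ᵐ ω ∂P, Y ω = X ω - β ^ m * Z ω := by
    filter_upwards [ae_eq_iterate h.equation t m] with ω hω
    simp only [hX, hY, hZ, score]
    rw [hω, inner_add_left, real_inner_smul_left]
    ring
  have hYL : MemLp Y 2 P := (memLp_congr_ae hXYZ).2 (hXL.sub (hZL.const_mul _))
  have hφm : Measurable[block ε (Set.Iic r)] φ := h.measurable_expSum_block a (by omega)
  have hYm : Measurable[block ε (Set.Ioi r)] Y := by
    have h1 : Measurable[block ε (Set.Ioi r)] W := by
      refine Finset.measurable_fun_sum _ fun j hj => ?_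
      have hj' := Finset.mem_range.1 hj
      have : Measurable[block ε (Set.Ioi r)] (ε ((t : ℤ) - j)) :=
        WAR.measurable_block ε (by simp only [Set.mem_Ioi]; omega)
      exact this.const_smul _
    exact h1.inner (WAR.measurable_block ε (by simpa using hrt))
  have hind : IndepFun φ (fun ω => ((Y ω ^ 2 - s : ℝ) : ℂ)) P := by
    refine indepFun_of_block h.measurable_noise h.indep (S := Set.Iic r) (T := Set.Ioi r)
      ?_ hφm (Complex.measurable_ofReal.comp ((hYm.pow_const 2).sub_const s))
    exact Set.disjoint_left.2 fun x hx hx' => not_lt.2 (Set.mem_Iic.1 hx) (Set.mem_Ioi.1 hx')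
  have hφm' : Measurable φ := hφm.mono (block_le h.measurable_noise _) le_rfl
  have hb : ∀ ω, ‖φ ω‖ = 1 := fun ω => norm_expSum _ a _ ω
  have hD : Integrable (fun ω => X ω ^ 2 - Y ω ^ 2) P := hXL.integrable_sq.sub hYL.integrable_sq
  have hYs : Integrable (fun ω => ((Y ω ^ 2 - s : ℝ) : ℂ)) P :=
    (hYL.integrable_sq.sub (integrable_const s)).ofReal
  have hsX : ∫ ω, X ω ^ 2 ∂P = s := h.integral_inner_sq (lt_add_one _)
  have hDle : ∫ ω, |X ω ^ 2 - Y ω ^ 2| ∂P ≤ 3 * B * |β| ^ m := by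
    have hX2 : ∫ ω, X ω ^ 2 ∂P ≤ B := h.integral_inner_sq_le (lt_add_one _)
    have hZ2 : ∫ ω, Z ω ^ 2 ∂P ≤ B := h.integral_inner_sq_le hrt
    calc ∫ ω, |X ω ^ 2 - Y ω ^ 2| ∂P ≤ ∫ ω, |β| ^ m * (X ω ^ 2 + 2 * Z ω ^ 2) ∂P := by
          refine integral_mono_ae hD.abs
            ((hXL.integrable_sq.add (hZL.integrable_sq.const_mul 2)).const_mul _) ?_
          filter_upwards [hXYZ] with ω hω
          have e : X ω ^ 2 - Y ω ^ 2 = β ^ m * (Z ω * (2 * X ω - β ^ m * Z ω)) := by rw [hω]; ring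
          have hbm : |β ^ m| ≤ 1 := by
            rw [abs_pow]
            exact pow_le_one₀ (abs_nonneg _) hβ.le
          rw [e, abs_mul, abs_pow]
          refine mul_le_mul_of_nonneg_left ?_ (by positivity)
          have hz : |Z ω| ^ 2 = Z ω ^ 2 := sq_abs _
          have hx : |X ω| ^ 2 = X ω ^ 2 := sq_abs _
          calc |Z ω * (2 * X ω - β ^ m * Z ω)| ≤ |Z ω| * (2 * |X ω| + 1 * |Z ω|) := by
                rw [abs_mul]
                refine mul_le_mul_of_nonneg_left ((abs_sub _ _).trans ?_) (abs_nonneg _)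
                rw [abs_mul, abs_mul (β ^ m), abs_two]
                gcongr
            _ ≤ X ω ^ 2 + 2 * Z ω ^ 2 := by nlinarith [sq_nonneg (|Z ω| - |X ω|)]
      _ = |β| ^ m * ((∫ ω, X ω ^ 2 ∂P) + 2 * ∫ ω, Z ω ^ 2 ∂P) := by
          rw [integral_const_mul, integral_add hXL.integrable_sq (hZL.integrable_sq.const_mul 2),
            integral_const_mul]
      _ ≤ |β| ^ m * (B + 2 * B) := by gcongr
      _ = _ := by ring
  have hφi : ∀ g : Ω → ℂ, Integrable g P → Integrable (fun ω => φ ω * g ω) P := fun g hg =>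
    hg.bdd_mul hφm'.aestronglyMeasurable (c := 1) (ae_of_all _ fun ω => (hb ω).le)
  have hDc : Integrable (fun ω => ((X ω ^ 2 - Y ω ^ 2 : ℝ) : ℂ)) P := hD.ofReal
  -- Independence factors the second integral. Since `E X² = s`, its mean `E(Y² - s)` equals `-E(X²
  -- - Y²)`, so both terms are at most `3 B |β|^m`; hence the constant 6.
  have hsplit : ∫ ω, φ ω * ((X ω ^ 2 - s : ℝ) : ℂ) ∂P =
      (∫ ω, φ ω * ((X ω ^ 2 - Y ω ^ 2 : ℝ) : ℂ) ∂P) +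
        (∫ ω, φ ω ∂P) * ∫ ω, ((Y ω ^ 2 - s : ℝ) : ℂ) ∂P := by
    rw [← hind.integral_fun_mul_eq_mul_integral hφm'.aestronglyMeasurable hYs.aestronglyMeasurable,
      ← integral_add (hφi _ hDc) (hφi _ hYs)]
    refine integral_congr_ae (ae_of_all _ fun ω => ?_)
    push_cast
    ring
  have b1 : ‖∫ ω, φ ω * ((X ω ^ 2 - Y ω ^ 2 : ℝ) : ℂ) ∂P‖ ≤ 3 * B * |β| ^ m := by
    refine (norm_integral_le_of_norm_le hD.abs (ae_of_all _ fun ω => ?_)).trans hDle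
    rw [norm_mul, hb, one_mul, Complex.norm_real, Real.norm_eq_abs]
  have b2 : ‖∫ ω, φ ω ∂P‖ ≤ 1 := by
    refine (norm_integral_le_of_norm_le (integrable_const (1 : ℝ))
      (ae_of_all _ fun ω => (hb ω).le)).trans ?_
    simp
  have b3 : ‖∫ ω, ((Y ω ^ 2 - s : ℝ) : ℂ) ∂P‖ ≤ 3 * B * |β| ^ m := by
    have e : ∫ ω, ((Y ω ^ 2 - s : ℝ) : ℂ) ∂P = ((-∫ ω, (X ω ^ 2 - Y ω ^ 2) ∂P : ℝ) : ℂ) := by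
      rw [integral_complex_ofReal, integral_sub hYL.integrable_sq (integrable_const s),
        integral_sub hXL.integrable_sq hYL.integrable_sq, hsX]
      simp
    rw [e, Complex.norm_real, Real.norm_eq_abs, abs_neg]
    exact abs_integral_le_integral_abs.trans hDle
  rw [hsplit]
  refine (norm_add_le _ _).trans ?_
  rw [norm_mul]
  have := mul_le_mul b2 b3 (norm_nonneg _) zero_le_one
  linarith

lemma isMixingDifference (h : IsCausalAR P β ε V) (hβ : |β| < 1) :
    IsMixingDifference P (fun t : ℕ => score ε V t) (∫ ω, score ε V 0 ω ^ 2 ∂P)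
      ((∫ ω, ‖V 0 ω‖ ^ 3 ∂P) * ∫ ω, ‖ε 0 ω‖ ^ 3 ∂P) where
  memLp t := h.memLp_score t
  moment_le t := h.integral_abs_score_pow_le t
  integral_expSum_mul a t := h.integral_expSum_mul_score a t
  decorrelation δ hδ := by
    have hlim := (tendsto_pow_atTop_nhds_zero_of_lt_one (abs_nonneg β) hβ).const_mul
      (6 * ((∫ ω, ‖V 0 ω‖ ^ 2 ∂P) * ∫ ω, ‖ε 0 ω‖ ^ 2 ∂P))
    rw [mul_zero] at hlim
    obtain ⟨m, hm⟩ := (hlim.eventually_lt_const hδ).exists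
    exact ⟨m, fun a t => (h.norm_integral_decorrelation_le hβ a m t).trans hm.le⟩

lemma tendstoInDistribution_sum_score (h : IsCausalAR P β ε V) (hβ : |β| < 1) :
    TendstoInDistribution (fun (n : ℕ) ω => (√n)⁻¹ * ∑ t ∈ Finset.range n, score ε V (t : ℤ) ω) atTop
      (id : ℝ → ℝ) (fun _ => P) (gaussianReal 0 (∫ ω, score ε V 0 ω ^ 2 ∂P).toNNReal) :=
  (h.isMixingDifference hβ).tendstoInDistribution (integral_nonneg fun _ => sq_nonneg _)

end IsCausalAR

end Autoregression

/-! ### Convergence in probability and the limit law of a ratio. -/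

section Slutsky

variable {Ω : Type*} {mΩ : MeasurableSpace Ω} {P : Measure Ω} [IsProbabilityMeasure P]

lemma tendstoInMeasure_zero_of_integral_bound {f g : ℕ → Ω → ℝ}
    (hg : ∀ᶠ n in atTop, Integrable (g n) P) (hfg : ∀ᶠ n in atTop, ∀ᵐ ω ∂P, |f n ω| ≤ g n ω)
    (hlim : Tendsto (fun n => ∫ ω, g n ω ∂P) atTop (𝓝 0)) :
    TendstoInMeasure P f atTop (fun _ => 0) := by
  rw [tendstoInMeasure_iff_measureReal_dist]
  intro η hη
  have hlim' := hlim.const_mul η⁻¹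
  rw [mul_zero] at hlim'
  refine squeeze_zero' (Eventually.of_forall fun n => measureReal_nonneg) ?_ hlim'
  filter_upwards [hg, hfg] with n h1 h2
  have hmar := mul_meas_ge_le_integral_of_nonneg (μ := P) (f := g n)
    (by filter_upwards [h2] with ω hω using (abs_nonneg _).trans hω) h1 η
  have hle : P.real {ω | η ≤ dist (f n ω) 0} ≤ P.real {ω | η ≤ g n ω} := by
    refine ENNReal.toReal_mono (measure_ne_top _ _) (measure_mono_ae ?_)
    filter_upwards [h2] with ω hω hη'
    have : η ≤ dist (f n ω) 0 := hη'
    rw [dist_zero_right, Real.norm_eq_abs] at this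
    exact this.trans hω
  rw [inv_mul_eq_div, le_div_iff₀ hη, mul_comm]
  exact (mul_le_mul_of_nonneg_left hle hη.le).trans hmar

lemma TendstoInMeasure.add_zero' {f g : ℕ → Ω → ℝ} {c : ℝ}
    (hf : TendstoInMeasure P f atTop (fun _ => c)) (hg : TendstoInMeasure P g atTop (fun _ => 0)) :
    TendstoInMeasure P (fun n ω => f n ω + g n ω) atTop (fun _ => c) := by
  rw [tendstoInMeasure_iff_dist] at *
  intro η hη
  have h := (hf (η / 2) (by positivity)).add (hg (η / 2) (by positivity))
  rw [add_zero] at h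
  refine tendsto_of_tendsto_of_tendsto_of_le_of_le tendsto_const_nhds h (fun _ => zero_le) fun n => ?_
  refine (measure_mono fun ω hω => ?_).trans (measure_union_le _ _)
  by_contra hcon
  simp only [Set.mem_union, not_or] at hcon
  obtain ⟨h1, h2⟩ := hcon
  have h1' : dist (f n ω) c < η / 2 := not_le.1 h1
  have h2' : dist (g n ω) 0 < η / 2 := not_le.1 h2
  have h3 : η ≤ dist (f n ω + g n ω) c := hω
  have h4 : dist (f n ω + g n ω) c ≤ dist (f n ω) c + dist (g n ω) 0 := by
    simpa using dist_add_add_le (f n ω) (g n ω) c 0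
  linarith

lemma TendstoInMeasure.comp_continuousAt {f : ℕ → Ω → ℝ} {c : ℝ}
    (hf : TendstoInMeasure P f atTop (fun _ => c)) {φ : ℝ → ℝ} (hφ : ContinuousAt φ c) :
    TendstoInMeasure P (fun n ω => φ (f n ω)) atTop (fun _ => φ c) := by
  rw [tendstoInMeasure_iff_dist] at *
  intro η hη
  obtain ⟨δ, hδ, h⟩ := Metric.continuousAt_iff.1 hφ η hη
  refine tendsto_of_tendsto_of_tendsto_of_le_of_le tendsto_const_nhds (hf δ hδ)
    (fun _ => zero_le) fun n => measure_mono fun ω hω => ?_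
  by_contra hcon
  exact absurd (h (not_le.1 hcon)) (not_lt.2 hω)

lemma tendstoInDistribution_id_of_map_eq {X : ℕ → Ω → ℝ} {ν ν' : Measure ℝ} [IsProbabilityMeasure ν]
    [IsProbabilityMeasure ν'] {Z : ℝ → ℝ} (h : TendstoInDistribution X atTop Z (fun _ => P) ν)
    (hlaw : ν.map Z = ν') : TendstoInDistribution X atTop (id : ℝ → ℝ) (fun _ => P) ν' := by
  refine ⟨h.forall_aemeasurable, aemeasurable_id, ?_⟩
  convert! h.tendsto using 2
  refine congrArg 𝓝 (Subtype.ext ?_)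
  change ν'.map id = ν.map Z
  rw [Measure.map_id, hlaw]

/-- The asymptotic distribution of a ratio `N_n / D_n`, when `D_n / n` converges in probability
and `N_n - β D_n` is asymptotically a normalized sum with Gaussian limit. -/
lemma tendstoInDistribution_sqrt_mul_div_sub {N D S : ℕ → Ω → ℝ} {β γ s : ℝ} (hγ : 0 < γ) (hs : 0 ≤ s)
    (hNm : ∀ n, Measurable (N n)) (hDm : ∀ n, Measurable (D n))
    (hSm : ∀ n, Measurable (S n))
    (hS : TendstoInDistribution (fun (n : ℕ) ω => (√n)⁻¹ * S n ω) atTop (id : ℝ → ℝ) (fun _ => P)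
      (gaussianReal 0 s.toNNReal))
    (hR : TendstoInMeasure P (fun (n : ℕ) ω => (√n)⁻¹ * (N n ω - β * D n ω - S n ω)) atTop
      (fun _ => 0))
    (hD : TendstoInMeasure P (fun (n : ℕ) ω => D n ω / n) atTop (fun _ => γ)) :
    TendstoInDistribution (fun (n : ℕ) ω => √n * (N n ω / D n ω - β)) atTop (id : ℝ → ℝ)
      (fun _ => P) (gaussianReal 0 (s / γ ^ 2).toNNReal) := by
  have hG : TendstoInMeasure P (fun (n : ℕ) ω => (D n ω / n)⁻¹) atTop (fun _ => γ⁻¹) :=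
    TendstoInMeasure.comp_continuousAt hD (continuousAt_inv₀ hγ.ne')
  have h1 := hS.add_of_tendstoInMeasure_const hR fun n => by
    have := hNm n; have := hDm n; have := hSm n; fun_prop
  have h2 := h1.continuous_comp_prodMk_of_tendstoInMeasure_const
    (g := fun x : ℝ × ℝ => x.1 * x.2) (by fun_prop) hG fun n => by
      have := hDm n; fun_prop
  have hZ : TendstoInMeasure P (fun (n : ℕ) ω => √n * (N n ω / D n ω - β) -
      ((√n)⁻¹ * S n ω + (√n)⁻¹ * (N n ω - β * D n ω - S n ω)) * (D n ω / n)⁻¹) atTop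
      (fun _ => 0) := by
    rw [tendstoInMeasure_iff_dist] at *
    intro η hη
    -- The difference is identically zero wherever `D n / n ≠ 0`; the remaining event forces `|D n /
    -- n - γ| ≥ γ`, whose probability vanishes.
    refine tendsto_of_tendsto_of_tendsto_of_le_of_le tendsto_const_nhds (hD γ hγ)
      (fun _ => zero_le) fun n => measure_mono fun ω hω => ?_
    by_contra hcon
    have h3 : D n ω / n ≠ 0 := by
      intro h0
      refine hcon ?_
      change γ ≤ dist (D n ω / n) γ
      rw [h0, dist_zero_left, Real.norm_eq_abs, abs_of_pos hγ]
    have hD0 : D n ω ≠ 0 := fun h => h3 (by rw [h, zero_div])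
    have hn0 : (n : ℝ) ≠ 0 := fun h => h3 (by rw [h, div_zero])
    have hsq : √(n : ℝ) ≠ 0 := Real.sqrt_ne_zero'.2 (by positivity)
    have hω' : η ≤ dist (√n * (N n ω / D n ω - β) -
      ((√n)⁻¹ * S n ω + (√n)⁻¹ * (N n ω - β * D n ω - S n ω)) * (D n ω / n)⁻¹) 0 := hω
    have hz : √n * (N n ω / D n ω - β) -
      ((√n)⁻¹ * S n ω + (√n)⁻¹ * (N n ω - β * D n ω - S n ω)) * (D n ω / n)⁻¹ = 0 := by
      field_simp
      rw [Real.sq_sqrt (Nat.cast_nonneg n)]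
      ring
    rw [hz, dist_self] at hω'
    exact absurd hη (not_lt.2 hω')
  have h3 := h2.add_of_tendstoInMeasure_const hZ fun n => by
    have := hNm n; have := hDm n; have := hSm n; fun_prop
  have hlaw : (gaussianReal 0 s.toNNReal).map (fun ω : ℝ => (id ω + 0) * γ⁻¹ + 0) =
      gaussianReal 0 (s / γ ^ 2).toNNReal := by
    simp only [id, add_zero]
    rw [gaussianReal_map_mul_const, mul_zero]
    congr 1
    ext
    push_cast
    rw [Real.coe_toNNReal _ hs, Real.coe_toNNReal _ (by positivity)]
    field_simp
  refine tendstoInDistribution_id_of_map_eq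
    (h3.congr (fun n => ae_of_all _ fun ω => ?_) (ae_of_all _ fun ω => rfl)) hlaw
  simp

end Slutsky

/-! ### Exact identities for empirical autocovariances along a solution. -/

section Algebra

variable {H : Type*} [NormedAddCommGroup H] [InnerProductSpace ℝ H]

/-- The empirical mean of `v_1, …, v_n`. -/
def empMean (v : ℤ → H) (n : ℕ) : H := (n : ℝ)⁻¹ • ∑ t ∈ Finset.Icc (1 : ℤ) n, v t

/-- The unnormalized empirical autocovariance of lag `h`. -/
def empAutocov (v : ℤ → H) (n h : ℕ) : ℝ :=
  ∑ t ∈ Finset.Icc (1 : ℤ) ((n : ℤ) - h), inner ℝ (v t - empMean v n) (v (t + h) - empMean v n)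

lemma sum_Icc_one_int {M : Type*} [AddCommMonoid M] (g : ℤ → M) (n : ℕ) :
    ∑ t ∈ Finset.Icc (1 : ℤ) n, g t = ∑ k ∈ Finset.range n, g (k + 1) := by
  induction n with
  | zero => simp
  | succ n ih =>
    rw [Finset.sum_range_succ, ← ih]
    have : Finset.Icc (1 : ℤ) ((n + 1 : ℕ) : ℤ) = insert ((n : ℤ) + 1) (Finset.Icc (1 : ℤ) n) := by
      ext x
      simp only [Finset.mem_Icc, Finset.mem_insert]
      push_cast
      omega
    rw [this, Finset.sum_insert (by simp), add_comm]

variable {β : ℝ} {v e : ℤ → H}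

/-- Summing the recursion telescopes, so the sum of the `v_t` is controlled by the noise sum and two
boundary terms. -/
lemma one_sub_smul_sum (hve : ∀ t, v t = β • v (t - 1) + e t) (n : ℕ) :
    (1 - β) • ∑ k ∈ Finset.range n, v ((k : ℤ) + 1) =
      β • (v 0 - v n) + ∑ k ∈ Finset.range n, e ((k : ℤ) + 1) := by
  induction n with
  | zero => simp
  | succ n ih =>
    rw [Finset.sum_range_succ, Finset.sum_range_succ, smul_add, ih]
    have := hve ((n : ℤ) + 1)
    rw [add_sub_cancel_right] at this
    have he : e ((n : ℤ) + 1) = v ((n : ℤ) + 1) - β • v n := by rw [this]; abel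
    rw [he]
    push_cast
    module

/-- Summing the squared norms of both sides of the recursion reduces the law of large numbers for
`‖v_t‖²` to that of the iid `‖e_t‖²`, without an ergodic theorem. -/
lemma one_sub_sq_mul_sum_norm_sq (hve : ∀ t, v t = β • v (t - 1) + e t) (n : ℕ) :
    (1 - β ^ 2) * ∑ k ∈ Finset.range n, ‖v ((k : ℤ) + 1)‖ ^ 2 =
      β ^ 2 * (‖v 0‖ ^ 2 - ‖v n‖ ^ 2) +
        2 * β * ∑ k ∈ Finset.range n, inner ℝ (v (k : ℤ)) (e ((k : ℤ) + 1)) +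
        ∑ k ∈ Finset.range n, ‖e ((k : ℤ) + 1)‖ ^ 2 := by
  induction n with
  | zero => simp
  | succ n ih =>
    rw [Finset.sum_range_succ, Finset.sum_range_succ, Finset.sum_range_succ, mul_add, ih]
    have := hve ((n : ℤ) + 1)
    rw [add_sub_cancel_right] at this
    have h2 : ‖v ((n : ℤ) + 1)‖ ^ 2 = β ^ 2 * ‖v n‖ ^ 2 +
        2 * β * inner ℝ (v (n : ℤ)) (e ((n : ℤ) + 1)) + ‖e ((n : ℤ) + 1)‖ ^ 2 := by
      rw [this, norm_add_sq_real, norm_smul, real_inner_smul_left, mul_pow, Real.norm_eq_abs, sq_abs]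
      ring
    push_cast
    linear_combination h2

lemma smul_empMean (v : ℤ → H) (n : ℕ) :
    (n : ℝ) • empMean v n = ∑ k ∈ Finset.range n, v ((k : ℤ) + 1) := by
  rw [empMean, sum_Icc_one_int, smul_smul]
  rcases n.eq_zero_or_pos with rfl | hn
  · simp
  · rw [mul_inv_cancel₀ (by exact_mod_cast hn.ne'), one_smul]

lemma empAutocov_zero (v : ℤ → H) (n : ℕ) :
    empAutocov v n 0 = (∑ k ∈ Finset.range n, ‖v ((k : ℤ) + 1)‖ ^ 2) - n * ‖empMean v n‖ ^ 2 := by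
  have h1 : empAutocov v n 0 =
      ∑ k ∈ Finset.range n, ‖v ((k : ℤ) + 1) - empMean v n‖ ^ 2 := by
    rw [empAutocov, Nat.cast_zero, sub_zero, sum_Icc_one_int]
    simp
  have h2 : ∑ k ∈ Finset.range n, inner ℝ (v ((k : ℤ) + 1)) (empMean v n) =
      n * ‖empMean v n‖ ^ 2 := by
    rw [← sum_inner, ← smul_empMean, real_inner_smul_left, real_inner_self_eq_norm_sq]
  simp only [h1, norm_sub_sq_real, Finset.sum_add_distrib, Finset.sum_sub_distrib,
    ← Finset.mul_sum, h2, Finset.sum_const, Finset.card_range, nsmul_eq_mul]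
  ring

/-- Substituting the recursion in the lag one products leaves the score sum, boundary terms, and
multiples of the squared mean. All terms on the right-hand side will be bounded in `L¹`. -/
lemma empAutocov_one_sub (hve : ∀ t, v t = β • v (t - 1) + e t) {n : ℕ} (hn : n ≠ 0) :
    empAutocov v n 1 - β * empAutocov v n 0 -
        ∑ k ∈ Finset.range n, inner ℝ (v (k : ℤ)) (e ((k : ℤ) + 1)) =
      -inner ℝ (v 0) (e 1) - β * ‖v n‖ ^ 2 - (n + 1) * ‖empMean v n‖ ^ 2 +
        inner ℝ (v 1 + v n) (empMean v n) + β * n * ‖empMean v n‖ ^ 2 := by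
  obtain ⟨N, rfl⟩ := Nat.exists_eq_succ_of_ne_zero hn
  set m := empMean v (N + 1) with hm
  have hT := smul_empMean v (N + 1)
  have h1 : empAutocov v (N + 1) 1 = ∑ k ∈ Finset.range N,
      (inner ℝ (v ((k : ℤ) + 1)) (v ((k : ℤ) + 1 + 1)) - inner ℝ (v ((k : ℤ) + 1)) m -
        inner ℝ (v ((k : ℤ) + 1 + 1)) m + ‖m‖ ^ 2) := by
    rw [empAutocov]
    have : (((N + 1 : ℕ) : ℤ) - (1 : ℕ)) = (N : ℤ) := by push_cast; ring
    rw [this, sum_Icc_one_int]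
    refine Finset.sum_congr rfl fun k _ => ?_
    rw [← hm, inner_sub_left, inner_sub_right, inner_sub_right, real_inner_self_eq_norm_sq,
      real_inner_comm (v _) m]
    push_cast
    ring
  have hstep : ∀ k : ℕ, inner ℝ (v ((k : ℤ) + 1)) (v ((k : ℤ) + 1 + 1)) =
      β * ‖v ((k : ℤ) + 1)‖ ^ 2 + inner ℝ (v ((k : ℤ) + 1)) (e ((k : ℤ) + 1 + 1)) := by
    intro k
    have := hve ((k : ℤ) + 1 + 1)
    rw [add_sub_cancel_right] at this
    rw [this, inner_add_right, real_inner_smul_right, real_inner_self_eq_norm_sq]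
  have hTm : ∑ k ∈ Finset.range (N + 1), inner ℝ (v ((k : ℤ) + 1)) m = (N + 1) * ‖m‖ ^ 2 := by
    rw [← sum_inner, ← hT, real_inner_smul_left, ← hm, real_inner_self_eq_norm_sq]
    push_cast
    ring
  have hA : ∑ k ∈ Finset.range N, inner ℝ (v ((k : ℤ) + 1)) m =
      (N + 1) * ‖m‖ ^ 2 - inner ℝ (v ((N + 1 : ℕ) : ℤ)) m := by
    rw [← hTm, Finset.sum_range_succ]
    push_cast
    ring
  have hB : ∑ k ∈ Finset.range N, inner ℝ (v ((k : ℤ) + 1 + 1)) m =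
      (N + 1) * ‖m‖ ^ 2 - inner ℝ (v 1) m := by
    rw [← hTm, Finset.sum_range_succ']
    push_cast
    simp
  -- The score sum starts at time 0, the lag one products at time 1; this leaves the boundary term
  -- `⟨v 0, e 1⟩`.
  have hS : ∑ k ∈ Finset.range (N + 1), inner ℝ (v (k : ℤ)) (e ((k : ℤ) + 1)) =
      (∑ k ∈ Finset.range N, inner ℝ (v ((k : ℤ) + 1)) (e ((k : ℤ) + 1 + 1))) + inner ℝ (v 0) (e 1) := by
    rw [Finset.sum_range_succ']
    push_cast
    simp
  have hQ : ∑ k ∈ Finset.range (N + 1), ‖v ((k : ℤ) + 1)‖ ^ 2 =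
      (∑ k ∈ Finset.range N, ‖v ((k : ℤ) + 1)‖ ^ 2) + ‖v ((N + 1 : ℕ) : ℤ)‖ ^ 2 := by
    rw [Finset.sum_range_succ]
    push_cast
    rfl
  have h1' : empAutocov v (N + 1) 1 = β * (∑ k ∈ Finset.range N, ‖v ((k : ℤ) + 1)‖ ^ 2) +
      (∑ k ∈ Finset.range N, inner ℝ (v ((k : ℤ) + 1)) (e ((k : ℤ) + 1 + 1))) -
      ((N + 1) * ‖m‖ ^ 2 - inner ℝ (v ((N + 1 : ℕ) : ℤ)) m) - ((N + 1) * ‖m‖ ^ 2 - inner ℝ (v 1) m)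
      + N * ‖m‖ ^ 2 := by
    rw [h1, Finset.sum_add_distrib, Finset.sum_sub_distrib, Finset.sum_sub_distrib,
      Finset.sum_congr rfl fun k _ => hstep k, Finset.sum_add_distrib, ← Finset.mul_sum, hA, hB]
    simp
  rw [h1', empAutocov_zero, hS, hQ, ← hm, inner_add_left]
  simp only [Nat.succ_eq_add_one]
  push_cast
  ring

lemma mul_norm_empMean_sq_le (hβ : β < 1) (hve : ∀ t, v t = β • v (t - 1) + e t)
    (hβ' : |β| ≤ 1) (n : ℕ) :
    n * ‖empMean v n‖ ^ 2 ≤ 3 / (1 - β) ^ 2 * ((n : ℝ)⁻¹ *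
      (‖v 0‖ ^ 2 + ‖v n‖ ^ 2 + ‖∑ k ∈ Finset.range n, e ((k : ℤ) + 1)‖ ^ 2)) := by
  rcases n.eq_zero_or_pos with rfl | hn
  · simp
  set U := ∑ k ∈ Finset.range n, e ((k : ℤ) + 1)
  have hn' : (0 : ℝ) < n := by exact_mod_cast hn
  have h1 : ((1 - β) * n) • empMean v n = β • (v 0 - v n) + U := by
    rw [mul_smul, smul_empMean, one_sub_smul_sum hve]
  have h2 : (1 - β) * n * ‖empMean v n‖ ≤ ‖v 0‖ + ‖v n‖ + ‖U‖ := by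
    have : ‖((1 - β) * n) • empMean v n‖ = (1 - β) * n * ‖empMean v n‖ := by
      rw [norm_smul, Real.norm_eq_abs, abs_of_pos (by have := sub_pos.2 hβ; positivity)]
    rw [← this, h1]
    refine (norm_add_le _ _).trans (add_le_add ?_ le_rfl)
    rw [norm_smul]
    calc ‖β‖ * ‖v 0 - v n‖ ≤ 1 * (‖v 0‖ + ‖v n‖) := by
          gcongr
          · exact hβ'
          · exact norm_sub_le _ _
      _ = _ := one_mul _
  have h3 : ((1 - β) * n * ‖empMean v n‖) ^ 2 ≤ 3 * (‖v 0‖ ^ 2 + ‖v n‖ ^ 2 + ‖U‖ ^ 2) := by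
    have h0 : 0 ≤ (1 - β) * n * ‖empMean v n‖ := by have := sub_pos.2 hβ; positivity
    refine (pow_le_pow_left₀ h0 h2 2).trans ?_
    nlinarith [sq_nonneg (‖v 0‖ - ‖v n‖), sq_nonneg (‖v 0‖ - ‖U‖), sq_nonneg (‖v n‖ - ‖U‖)]
  have h4 : 0 < (1 - β) ^ 2 := by have := sub_pos.2 hβ; positivity
  have h5 : 3 / (1 - β) ^ 2 * ((n : ℝ)⁻¹ * (‖v 0‖ ^ 2 + ‖v n‖ ^ 2 + ‖U‖ ^ 2)) =
      (3 * (‖v 0‖ ^ 2 + ‖v n‖ ^ 2 + ‖U‖ ^ 2)) / ((1 - β) ^ 2 * n) := by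
    field_simp
  rw [h5, le_div_iff₀ (by positivity)]
  refine le_trans (le_of_eq ?_) h3
  ring

end Algebra

/-! ### Second moments, negligible remainders and the limit law of the empirical autocorrelation. -/

section RatioCLT

variable {Ω : Type*} {mΩ : MeasurableSpace Ω} {P : Measure Ω}
variable {H : Type*} [NormedAddCommGroup H] [InnerProductSpace ℝ H] [CompleteSpace H]
  [SecondCountableTopology H] [MeasurableSpace H] [BorelSpace H]

lemma integrable_inner_of_memLp {A B : Ω → H} (hA : MemLp A 2 P) (hB : MemLp B 2 P) :
    Integrable (fun ω => (inner ℝ (A ω) (B ω) : ℝ)) P :=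
  (hA.norm.integrable_mul hB.norm).mono' (hA.aestronglyMeasurable.inner hB.aestronglyMeasurable)
    (ae_of_all _ fun _ => norm_inner_le_norm _ _)

namespace IsCausalAR

variable [IsProbabilityMeasure P] {β : ℝ} {ε V : ℤ → Ω → H}

lemma integrable_norm_sq (h : IsCausalAR P β ε V) (t : ℤ) : Integrable (fun ω => ‖V t ω‖ ^ 2) P :=
  (h.memLp_two t).integrable_norm_pow (by norm_num)

lemma integrable_norm_noise_sq (h : IsCausalAR P β ε V) (t : ℤ) :
    Integrable (fun ω => ‖ε t ω‖ ^ 2) P :=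
  (h.memLp_two_noise t).integrable_norm_pow (by norm_num)

lemma ae_equation (h : IsCausalAR P β ε V) :
    ∀ᵐ ω ∂P, ∀ t, V t ω = β • V (t - 1) ω + ε t ω := ae_all_iff.2 h.equation

lemma memLp_sum_score (h : IsCausalAR P β ε V) (n : ℕ) :
    MemLp (fun ω => ∑ k ∈ Finset.range n, score ε V (k : ℤ) ω) 2 P :=
  memLp_finsetSum _ fun k _ => h.memLp_two_score k

lemma memLp_sum_noise (h : IsCausalAR P β ε V) (n : ℕ) :
    MemLp (fun ω => ∑ k ∈ Finset.range n, ε ((k : ℤ) + 1) ω) 2 P :=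
  memLp_finsetSum _ fun _ _ => h.memLp_two_noise _

/-- Martingale differences are orthogonal, so the cross term of each induction step vanishes. -/
lemma integral_sum_score_sq (h : IsCausalAR P β ε V) (n : ℕ) :
    ∫ ω, (∑ k ∈ Finset.range n, score ε V (k : ℤ) ω) ^ 2 ∂P =
      n * ∫ ω, score ε V 0 ω ^ 2 ∂P := by
  induction n with
  | zero => simp
  | succ n ih =>
    set S : Ω → ℝ := fun ω => ∑ k ∈ Finset.range n, score ε V (k : ℤ) ω with hS
    have hSL : MemLp S 2 P := h.memLp_sum_score n
    have hXL : MemLp (score ε V (n : ℤ)) 2 P := h.memLp_two_score n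
    have hSm : Measurable[block ε (Set.Iic (n : ℤ))] S :=
      Finset.measurable_fun_sum _ fun k hk => h.measurable_score_block (by
        have := Finset.mem_range.1 hk
        omega)
    have hcross : ∫ ω, S ω * score ε V (n : ℤ) ω ∂P = 0 := by
      refine h.integral_mul_score_eq_zero n hSm ?_
      have := (h.memLp_two n).smul (p := 2) (q := 2) (r := 1) hSL
      exact memLp_one_iff_integrable.1 this
    have hSX : Integrable (fun ω => S ω * score ε V (n : ℤ) ω) P := hSL.integrable_mul hXL
    have hx : ∫ ω, score ε V (n : ℤ) ω ^ 2 ∂P = ∫ ω, score ε V 0 ω ^ 2 ∂P :=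
      h.integral_inner_sq (lt_add_one _)
    have e1 : Integrable (fun ω => S ω ^ 2 + 2 * (S ω * score ε V (n : ℤ) ω)) P :=
      hSL.integrable_sq.add (hSX.const_mul 2)
    calc _ = ∫ ω, (S ω ^ 2 + 2 * (S ω * score ε V (n : ℤ) ω) + score ε V (n : ℤ) ω ^ 2) ∂P := by
          refine integral_congr_ae (ae_of_all _ fun ω => ?_)
          simp only [Finset.sum_range_succ, hS]
          ring
      _ = _ := by
          rw [integral_add e1 hXL.integrable_sq,
            integral_add hSL.integrable_sq (hSX.const_mul 2), integral_const_mul, hcross, hx, ih]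
          push_cast
          ring

lemma integral_norm_sum_noise_sq (h : IsCausalAR P β ε V) (n : ℕ) :
    ∫ ω, ‖∑ k ∈ Finset.range n, ε ((k : ℤ) + 1) ω‖ ^ 2 ∂P = n * ∫ ω, ‖ε 0 ω‖ ^ 2 ∂P := by
  induction n with
  | zero => simp
  | succ n ih =>
    set U : Ω → H := fun ω => ∑ k ∈ Finset.range n, ε ((k : ℤ) + 1) ω with hU
    have hUL : MemLp U 2 P := h.memLp_sum_noise n
    have hEL : MemLp (ε ((n : ℤ) + 1)) 2 P := h.memLp_two_noise _
    have hUm : Measurable[block ε (Set.Iic (n : ℤ))] U :=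
      Finset.measurable_fun_sum _ fun k hk => WAR.measurable_block ε (by
        have := Finset.mem_range.1 hk
        simp only [Set.mem_Iic]
        omega)
    have hind : IndepFun U (ε ((n : ℤ) + 1)) P :=
      indepFun_of_block h.measurable_noise h.indep (S := Set.Iic (n : ℤ)) (T := {(n : ℤ) + 1})
        (by rw [Set.disjoint_singleton_right]; simp) hUm (WAR.measurable_block ε rfl)
    have hcross := integral_inner_eq_zero hind (hUL.integrable (by norm_num))
      (hEL.integrable (by norm_num)) (h.integral_noise _)
    have hUE : Integrable (fun ω => (inner ℝ (U ω) (ε ((n : ℤ) + 1) ω) : ℝ)) P :=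
      integrable_inner_of_memLp hUL hEL
    have hU2 : Integrable (fun ω => ‖U ω‖ ^ 2) P := hUL.integrable_norm_pow (by norm_num)
    have e1 : Integrable (fun ω => ‖U ω‖ ^ 2 + 2 * inner ℝ (U ω) (ε ((n : ℤ) + 1) ω)) P :=
      hU2.add (hUE.const_mul 2)
    calc _ = ∫ ω, (‖U ω‖ ^ 2 + 2 * inner ℝ (U ω) (ε ((n : ℤ) + 1) ω) +
          ‖ε ((n : ℤ) + 1) ω‖ ^ 2) ∂P := by
          refine integral_congr_ae (ae_of_all _ fun ω => ?_)
          simp only [Finset.sum_range_succ, hU]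
          rw [norm_add_sq_real]
      _ = _ := by
          rw [integral_add e1 (h.integrable_norm_noise_sq _), integral_add hU2 (hUE.const_mul 2),
            integral_const_mul, hcross, ih, h.integral_norm_noise_pow ((n : ℤ) + 1)]
          push_cast
          ring

lemma one_sub_sq_mul_integral_norm_sq (h : IsCausalAR P β ε V) :
    (1 - β ^ 2) * ∫ ω, ‖V 0 ω‖ ^ 2 ∂P = ∫ ω, ‖ε 0 ω‖ ^ 2 ∂P := by
  have hcross : ∫ ω, inner ℝ (V (-1) ω) (ε 0 ω) ∂P = 0 :=
    integral_inner_eq_zero (h.indepFun_future (by norm_num)) ((h.memLp _).integrable (by norm_num))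
      ((h.memLp_noise _).integrable (by norm_num)) (h.integral_noise _)
  have hi : Integrable (fun ω => (inner ℝ (V (-1) ω) (ε 0 ω) : ℝ)) P :=
    integrable_inner_of_memLp (h.memLp_two _) (h.memLp_two_noise _)
  have e1 : Integrable (fun ω => β ^ 2 * ‖V (-1) ω‖ ^ 2 + 2 * β * inner ℝ (V (-1) ω) (ε 0 ω)) P :=
    ((h.integrable_norm_sq _).const_mul _).add (hi.const_mul _)
  have : ∫ ω, ‖V 0 ω‖ ^ 2 ∂P = ∫ ω, (β ^ 2 * ‖V (-1) ω‖ ^ 2 +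
      2 * β * inner ℝ (V (-1) ω) (ε 0 ω) + ‖ε 0 ω‖ ^ 2) ∂P := by
    refine integral_congr_ae ?_
    filter_upwards [h.equation 0] with ω hω
    rw [hω, zero_sub, norm_add_sq_real, norm_smul, real_inner_smul_left, mul_pow, Real.norm_eq_abs,
      sq_abs]
    ring
  rw [integral_add e1 (h.integrable_norm_noise_sq _),
    integral_add ((h.integrable_norm_sq _).const_mul _) (hi.const_mul _), integral_const_mul,
    integral_const_mul, hcross, h.integral_norm_pow (-1)] at this
  linear_combination this

/-- Expand `V_0 = β V_{-1} + ε_0` in `⟨V_0, ε_1⟩²`. The cross term is the scalar product of the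
centred `ε_0` with a vector built from `V_{-1}` and `ε_1`, which is independent of it. -/
lemma one_sub_sq_mul_integral_score_sq (h : IsCausalAR P β ε V) :
    (1 - β ^ 2) * ∫ ω, score ε V 0 ω ^ 2 ∂P = ∫ ω, inner ℝ (ε 0 ω) (ε 1 ω) ^ 2 ∂P := by
  set Z : Ω → ℝ := fun ω => inner ℝ (V (-1) ω) (ε 1 ω) with hZ
  set Y : Ω → ℝ := fun ω => inner ℝ (ε 0 ω) (ε 1 ω) with hY
  have hZL : MemLp Z 2 P := (memLp_inner_of_indepFun (h.indepFun_future (by norm_num)) (k := 2)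
    (by norm_num) (h.memLp_two _) (h.memLp_two_noise _)).1
  have hind01 : IndepFun (ε 0) (ε 1) P := h.indep.indepFun (by norm_num)
  have hYL : MemLp Y 2 P := (memLp_inner_of_indepFun hind01 (k := 2)
    (by norm_num) (h.memLp_two_noise _) (h.memLp_two_noise _)).1
  have hind : IndepFun (fun ω => Z ω • ε 1 ω) (ε 0) P := by
    have h1 : Measurable[block ε (Set.Iic (-1) ∪ {1})] (ε 1) :=
      WAR.measurable_block ε (by simp)
    have h2 : Measurable[block ε (Set.Iic (-1) ∪ {1})] (V (-1)) :=
      (h.measurable_block (-1)).mono (block_mono ε Set.subset_union_left) le_rfl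
    exact indepFun_of_block h.measurable_noise h.indep (S := Set.Iic (-1) ∪ {1}) (T := {0})
      (by simp) ((h2.inner h1).smul h1) (WAR.measurable_block ε rfl)
  have hcross : ∫ ω, Z ω * Y ω ∂P = 0 := by
    have h1 : Integrable (fun ω => Z ω • ε 1 ω) P :=
      memLp_one_iff_integrable.1 ((h.memLp_two_noise 1).smul (p := 2) (q := 2) (r := 1) hZL)
    have := integral_inner_eq_zero hind h1 ((h.memLp_noise _).integrable (by norm_num))
      (h.integral_noise _)
    simpa only [real_inner_smul_left, real_inner_comm (ε 0 _) (ε 1 _), hY] using this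
  have hZY : Integrable (fun ω => Z ω * Y ω) P := hZL.integrable_mul hYL
  have hZ2 : ∫ ω, Z ω ^ 2 ∂P = ∫ ω, score ε V 0 ω ^ 2 ∂P := h.integral_inner_sq (by norm_num)
  have e1 : Integrable (fun ω => β ^ 2 * Z ω ^ 2 + 2 * β * (Z ω * Y ω)) P :=
    (hZL.integrable_sq.const_mul _).add (hZY.const_mul _)
  have : ∫ ω, score ε V 0 ω ^ 2 ∂P =
      ∫ ω, (β ^ 2 * Z ω ^ 2 + 2 * β * (Z ω * Y ω) + Y ω ^ 2) ∂P := by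
    refine integral_congr_ae ?_
    filter_upwards [h.equation 0] with ω hω
    rw [score, hω, zero_sub, zero_add, inner_add_left, real_inner_smul_left]
    simp only [hZ, hY]
    ring
  rw [integral_add e1 hYL.integrable_sq, integral_add (hZL.integrable_sq.const_mul _)
    (hZY.const_mul _), integral_const_mul, integral_const_mul, hcross, hZ2] at this
  linear_combination this

lemma measurable_empAutocov (h : IsCausalAR P β ε V) (n k : ℕ) :
    Measurable (fun ω => empAutocov (fun t => V t ω) n k) := by
  have hV := h.measurable
  unfold empAutocov empMean
  fun_prop

/-- The bound for the squared empirical mean. -/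
def meanBound (β : ℝ) (ε V : ℤ → Ω → H) (n : ℕ) (ω : Ω) : ℝ :=
  3 / (1 - β) ^ 2 * ((n : ℝ)⁻¹ *
    (‖V 0 ω‖ ^ 2 + ‖V n ω‖ ^ 2 + ‖∑ k ∈ Finset.range n, ε ((k : ℤ) + 1) ω‖ ^ 2))

lemma integrable_meanBound (h : IsCausalAR P β ε V) (n : ℕ) :
    Integrable (meanBound β ε V n) P :=
  ((((h.integrable_norm_sq 0).add (h.integrable_norm_sq n)).add
    ((h.memLp_sum_noise n).integrable_norm_pow (p := 2) (by norm_num))).const_mul _).const_mul _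

lemma integral_meanBound_le (h : IsCausalAR P β ε V) {n : ℕ} (hn : n ≠ 0) :
    ∫ ω, meanBound β ε V n ω ∂P ≤
      3 / (1 - β) ^ 2 * (2 * (∫ ω, ‖V 0 ω‖ ^ 2 ∂P) + ∫ ω, ‖ε 0 ω‖ ^ 2 ∂P) := by
  have hn' : (1 : ℝ) ≤ n := by exact_mod_cast Nat.one_le_iff_ne_zero.2 hn
  have e1 : Integrable (fun ω => ‖V 0 ω‖ ^ 2 + ‖V n ω‖ ^ 2) P :=
    (h.integrable_norm_sq 0).add (h.integrable_norm_sq n)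
  have e2 : Integrable (fun ω => ‖∑ k ∈ Finset.range n, ε ((k : ℤ) + 1) ω‖ ^ 2) P :=
    (h.memLp_sum_noise n).integrable_norm_pow (p := 2) (by norm_num)
  have hv : 0 ≤ ∫ ω, ‖V 0 ω‖ ^ 2 ∂P := integral_nonneg fun _ => by positivity
  unfold meanBound
  rw [integral_const_mul, integral_const_mul, integral_add e1 e2,
    integral_add (h.integrable_norm_sq 0) (h.integrable_norm_sq n), h.integral_norm_pow n,
    h.integral_norm_sum_noise_sq]
  refine mul_le_mul_of_nonneg_left ?_ (by positivity)
  rw [inv_mul_le_iff₀ (by positivity)]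
  nlinarith

lemma tendstoInMeasure_remainder (h : IsCausalAR P β ε V) (hβ : |β| < 1) :
    TendstoInMeasure P (fun (n : ℕ) ω => (√n)⁻¹ * (empAutocov (fun t => V t ω) n 1 -
      β * empAutocov (fun t => V t ω) n 0 - ∑ k ∈ Finset.range n, score ε V (k : ℤ) ω)) atTop
      (fun _ => 0) := by
  set v2 := ∫ ω, ‖V 0 ω‖ ^ 2 ∂P with hv2
  set C := 3 / (1 - β) ^ 2 * (2 * v2 + ∫ ω, ‖ε 0 ω‖ ^ 2 ∂P) with hC
  have hX : Integrable (score ε V 0) P := (h.memLp_score 0).integrable (by norm_num)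
  have hi : ∀ n : ℕ, Integrable (fun ω => |score ε V 0 ω| + 2 * ‖V n ω‖ ^ 2 + ‖V 1 ω‖ ^ 2 +
      4 * meanBound β ε V n ω) P := fun n =>
    ((hX.abs.add ((h.integrable_norm_sq n).const_mul 2)).add (h.integrable_norm_sq 1)).add
      ((h.integrable_meanBound n).const_mul 4)
  -- The terms in `m = V̄` add up to at most `4 n ‖m‖²`: two from `(n + 1) ‖m‖²`, one from the
  -- scalar product and one from `β n ‖m‖²`. The two copies of `‖V_n‖²` come from `β ‖V_n‖²` and the
  -- scalar product.
  refine tendstoInMeasure_zero_of_integral_bound (g := fun (n : ℕ) ω => (√n)⁻¹ *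
    (|score ε V 0 ω| + 2 * ‖V n ω‖ ^ 2 + ‖V 1 ω‖ ^ 2 + 4 * meanBound β ε V n ω))
    (Eventually.of_forall fun n => (hi n).const_mul _) ?_ ?_
  · filter_upwards [eventually_ne_atTop 0] with n hn
    filter_upwards [h.ae_equation] with ω hω
    have hm := mul_norm_empMean_sq_le (lt_of_abs_lt hβ) hω hβ.le n
    have hn' : (1 : ℝ) ≤ n := by exact_mod_cast Nat.one_le_iff_ne_zero.2 hn
    set m := empMean (fun t => V t ω) n with hm_def
    change n * ‖m‖ ^ 2 ≤ meanBound β ε V n ω at hm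
    rw [abs_mul, abs_of_nonneg (by positivity : 0 ≤ (√(n : ℝ))⁻¹)]
    refine mul_le_mul_of_nonneg_left ?_ (by positivity)
    have hrem := empAutocov_one_sub (v := fun t => V t ω) (e := fun t => ε t ω) hω hn
    change empAutocov (fun t => V t ω) n 1 - β * empAutocov (fun t => V t ω) n 0 -
      ∑ k ∈ Finset.range n, score ε V (k : ℤ) ω = -score ε V 0 ω - β * ‖V n ω‖ ^ 2 -
      (n + 1) * ‖m‖ ^ 2 + inner ℝ (V 1 ω + V n ω) m + β * n * ‖m‖ ^ 2 at hrem
    have hin : |(inner ℝ (V 1 ω + V n ω) m : ℝ)| ≤ ‖V 1 ω‖ ^ 2 + ‖V n ω‖ ^ 2 + ‖m‖ ^ 2 := by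
      refine (abs_real_inner_le_norm _ _).trans ?_
      have := norm_add_le (V 1 ω) (V n ω)
      have h1 : ‖V 1 ω + V n ω‖ * ‖m‖ ≤ (‖V 1 ω‖ + ‖V n ω‖) * ‖m‖ := by gcongr
      nlinarith [sq_nonneg (‖V 1 ω‖ - ‖V n ω‖), sq_nonneg (‖V 1 ω‖ + ‖V n ω‖ - 2 * ‖m‖)]
    rw [hrem]
    have hb := abs_le.1 hβ.le
    have hin' := abs_le.1 hin
    have hs' := abs_le.1 (le_refl |score ε V 0 ω|)
    have hvn : 0 ≤ ‖V n ω‖ ^ 2 := by positivity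
    have hv1 : 0 ≤ ‖V 1 ω‖ ^ 2 := by positivity
    have hm0 : 0 ≤ ‖m‖ ^ 2 := by positivity
    have hm1 : ‖m‖ ^ 2 ≤ n * ‖m‖ ^ 2 := by nlinarith
    have hq1 : β * ‖V n ω‖ ^ 2 ≤ ‖V n ω‖ ^ 2 := by nlinarith
    have hq2 : -‖V n ω‖ ^ 2 ≤ β * ‖V n ω‖ ^ 2 := by nlinarith
    have hq3 : β * (n * ‖m‖ ^ 2) ≤ n * ‖m‖ ^ 2 := by nlinarith
    have hq4 : -(n * ‖m‖ ^ 2) ≤ β * (n * ‖m‖ ^ 2) := by nlinarith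
    rw [abs_le]
    constructor <;> nlinarith
  · have hle : ∀ᶠ n : ℕ in atTop, ∫ ω, (√n)⁻¹ * (|score ε V 0 ω| + 2 * ‖V n ω‖ ^ 2 + ‖V 1 ω‖ ^ 2 +
        4 * meanBound β ε V n ω) ∂P ≤
        (√n)⁻¹ * ((∫ ω, |score ε V 0 ω| ∂P) + 2 * v2 + v2 + 4 * C) := by
      filter_upwards [eventually_ne_atTop 0] with n hn
      have e1 : Integrable (fun ω => |score ε V 0 ω| + 2 * ‖V n ω‖ ^ 2) P :=
        hX.abs.add ((h.integrable_norm_sq n).const_mul 2)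
      have e2 : Integrable (fun ω => |score ε V 0 ω| + 2 * ‖V n ω‖ ^ 2 + ‖V 1 ω‖ ^ 2) P :=
        e1.add (h.integrable_norm_sq 1)
      rw [integral_const_mul, integral_add e2 ((h.integrable_meanBound n).const_mul 4),
        integral_add e1 (h.integrable_norm_sq 1),
        integral_add hX.abs ((h.integrable_norm_sq n).const_mul 2), integral_const_mul,
        integral_const_mul, h.integral_norm_pow n, h.integral_norm_pow 1]
      gcongr
      exact h.integral_meanBound_le hn
    have hlim : Tendsto (fun n : ℕ => (√n)⁻¹ *
        ((∫ ω, |score ε V 0 ω| ∂P) + 2 * v2 + v2 + 4 * C)) atTop (𝓝 0) := by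
      have h1 : Tendsto (fun n : ℕ => (√n)⁻¹) atTop (𝓝 0) :=
        tendsto_inv_atTop_zero.comp (Real.tendsto_sqrt_atTop.comp tendsto_natCast_atTop_atTop)
      simpa using h1.mul_const ((∫ ω, |score ε V 0 ω| ∂P) + 2 * v2 + v2 + 4 * C)
    refine squeeze_zero' (Eventually.of_forall fun n => integral_nonneg fun ω => ?_) hle hlim
    have : 0 ≤ meanBound β ε V n ω := by unfold meanBound; positivity
    positivity

/-- The strong law for `‖ε_t‖²` gives the limit through the squared-norm identity; boundary terms,
the score sum and the squared mean all vanish in `L¹` after division by `n`. -/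
lemma tendstoInMeasure_empAutocov_zero_div (h : IsCausalAR P β ε V) (hβ : |β| < 1) :
    TendstoInMeasure P (fun (n : ℕ) ω => empAutocov (fun t => V t ω) n 0 / n) atTop
      (fun _ => ∫ ω, ‖V 0 ω‖ ^ 2 ∂P) := by
  set v2 := ∫ ω, ‖V 0 ω‖ ^ 2 ∂P with hv2
  set s := ∫ ω, score ε V 0 ω ^ 2 ∂P with hs
  have hβ2 : 0 < 1 - β ^ 2 := by
    have := (sq_lt_one_iff_abs_lt_one β).2 hβ
    linarith
  have hmain : TendstoInMeasure P (fun (n : ℕ) ω =>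
      (1 - β ^ 2)⁻¹ * ((∑ k ∈ Finset.range n, ‖ε ((k : ℤ) + 1) ω‖ ^ 2) / n)) atTop
      (fun _ => v2) := by
    have hmeas : ∀ t : ℤ, Measurable fun ω => ‖ε t ω‖ ^ 2 := fun t =>
      (h.measurable_noise t).norm.pow_const 2
    refine tendstoInMeasure_of_tendsto_ae (fun n => Measurable.aestronglyMeasurable ?_) ?_
    · fun_prop
    · have hpair : Pairwise (Function.onFun (fun f g => IndepFun f g P)
          (fun (k : ℕ) ω => ‖ε ((k : ℤ) + 1) ω‖ ^ 2)) := fun i j hij =>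
        (h.indep.indepFun (by omega : (i : ℤ) + 1 ≠ (j : ℤ) + 1)).comp
          (φ := fun x => ‖x‖ ^ 2) (ψ := fun x => ‖x‖ ^ 2) (by fun_prop) (by fun_prop)
      have hident : ∀ k : ℕ, IdentDistrib (fun ω => ‖ε ((k : ℤ) + 1) ω‖ ^ 2)
          (fun ω => ‖ε (((0 : ℕ) : ℤ) + 1) ω‖ ^ 2) P P := fun k =>
        ((h.identDistrib_noise _).trans (h.identDistrib_noise _).symm).comp
          (u := fun x => ‖x‖ ^ 2) (by fun_prop)
      have := strong_law_ae_real (fun (k : ℕ) ω => ‖ε ((k : ℤ) + 1) ω‖ ^ 2)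
        (h.integrable_norm_noise_sq _) hpair hident
      filter_upwards [this] with ω hω
      have h2 := hω.const_mul (1 - β ^ 2)⁻¹
      rwa [h.integral_norm_noise_pow, ← h.one_sub_sq_mul_integral_norm_sq, ← mul_assoc,
        inv_mul_cancel₀ hβ2.ne', one_mul] at h2
  have hrest : TendstoInMeasure P (fun (n : ℕ) ω => empAutocov (fun t => V t ω) n 0 / n -
      (1 - β ^ 2)⁻¹ * ((∑ k ∈ Finset.range n, ‖ε ((k : ℤ) + 1) ω‖ ^ 2) / n)) atTop
      (fun _ => 0) := by
    set S : ℕ → Ω → ℝ := fun n ω => ∑ k ∈ Finset.range n, score ε V (k : ℤ) ω with hS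
    set c := (1 - β ^ 2)⁻¹ with hc
    have hc0 : 0 < c := inv_pos.2 hβ2
    have hi1 : ∀ n : ℕ, Integrable (fun ω => ‖V 0 ω‖ ^ 2 + ‖V n ω‖ ^ 2) P := fun n =>
      (h.integrable_norm_sq 0).add (h.integrable_norm_sq n)
    have hi2 : ∀ n : ℕ, Integrable (fun ω => (n : ℝ)⁻¹ * S n ω ^ 2 + 1) P := fun n =>
      ((h.memLp_sum_score n).integrable_sq.const_mul _).add (integrable_const 1)
    have hi3 : ∀ n : ℕ, Integrable (fun ω => c * ((n : ℝ)⁻¹ * (‖V 0 ω‖ ^ 2 + ‖V n ω‖ ^ 2)) +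
      c * ((√n)⁻¹ * ((n : ℝ)⁻¹ * S n ω ^ 2 + 1))) P := fun n =>
      (((hi1 n).const_mul _).const_mul _).add (((hi2 n).const_mul _).const_mul _)
    refine tendstoInMeasure_zero_of_integral_bound (g := fun (n : ℕ) ω =>
      c * ((n : ℝ)⁻¹ * (‖V 0 ω‖ ^ 2 + ‖V n ω‖ ^ 2)) +
      c * ((√n)⁻¹ * ((n : ℝ)⁻¹ * S n ω ^ 2 + 1)) + (n : ℝ)⁻¹ * meanBound β ε V n ω)
      (Eventually.of_forall fun n => (hi3 n).add ((h.integrable_meanBound n).const_mul _)) ?_ ?_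
    · filter_upwards [eventually_ne_atTop 0] with n hn
      filter_upwards [h.ae_equation] with ω hω
      have hm := mul_norm_empMean_sq_le (lt_of_abs_lt hβ) hω hβ.le n
      have hn' : (0 : ℝ) < n := by exact_mod_cast Nat.pos_of_ne_zero hn
      have hden := one_sub_sq_mul_sum_norm_sq (v := fun t => V t ω) (e := fun t => ε t ω) hω n
      change _ = β ^ 2 * (‖V 0 ω‖ ^ 2 - ‖V n ω‖ ^ 2) + 2 * β * S n ω +
        ∑ k ∈ Finset.range n, ‖ε ((k : ℤ) + 1) ω‖ ^ 2 at hden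
      rw [empAutocov_zero]
      set m := empMean (fun t => V t ω) n with hm_def
      change n * ‖m‖ ^ 2 ≤ meanBound β ε V n ω at hm
      have hEq : ((∑ k ∈ Finset.range n, ‖V ((k : ℤ) + 1) ω‖ ^ 2) - n * ‖m‖ ^ 2) / n -
          c * ((∑ k ∈ Finset.range n, ‖ε ((k : ℤ) + 1) ω‖ ^ 2) / n) =
          c * ((n : ℝ)⁻¹ * (β ^ 2 * (‖V 0 ω‖ ^ 2 - ‖V n ω‖ ^ 2))) +
          c * (β * ((n : ℝ)⁻¹ * (2 * S n ω))) - (n : ℝ)⁻¹ * (n * ‖m‖ ^ 2) := by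
        have h1 : ∑ k ∈ Finset.range n, ‖V ((k : ℤ) + 1) ω‖ ^ 2 =
            c * (β ^ 2 * (‖V 0 ω‖ ^ 2 - ‖V n ω‖ ^ 2) + 2 * β * S n ω +
        ∑ k ∈ Finset.range n, ‖ε ((k : ℤ) + 1) ω‖ ^ 2) := by
          rw [← hden, hc, ← mul_assoc, inv_mul_cancel₀ hβ2.ne', one_mul]
        rw [h1, div_eq_inv_mul, div_eq_inv_mul]
        ring
      have t1 : |c * ((n : ℝ)⁻¹ * (β ^ 2 * (‖V 0 ω‖ ^ 2 - ‖V n ω‖ ^ 2)))| ≤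
          c * ((n : ℝ)⁻¹ * (‖V 0 ω‖ ^ 2 + ‖V n ω‖ ^ 2)) := by
        rw [abs_mul, abs_of_pos hc0, abs_mul, abs_of_pos (inv_pos.2 hn'), abs_mul,
          abs_of_nonneg (sq_nonneg β)]
        refine mul_le_mul_of_nonneg_left (mul_le_mul_of_nonneg_left ?_ (by positivity)) hc0.le
        calc β ^ 2 * |‖V 0 ω‖ ^ 2 - ‖V n ω‖ ^ 2| ≤ 1 * (‖V 0 ω‖ ^ 2 + ‖V n ω‖ ^ 2) := by
              refine mul_le_mul (by linarith) ((abs_sub _ _).trans_eq ?_) (abs_nonneg _) zero_le_one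
              rw [abs_of_nonneg (by positivity), abs_of_nonneg (by positivity)]
          _ = _ := one_mul _
      have t2 : |c * (β * ((n : ℝ)⁻¹ * (2 * S n ω)))| ≤
          c * ((√n)⁻¹ * ((n : ℝ)⁻¹ * S n ω ^ 2 + 1)) := by
        rw [abs_mul, abs_of_pos hc0, abs_mul]
        refine mul_le_mul_of_nonneg_left ?_ hc0.le
        refine (mul_le_of_le_one_left (abs_nonneg _) hβ.le).trans ?_
        set q := √(n : ℝ) with hq
        have hq0 : 0 < q := Real.sqrt_pos.2 hn'
        have hqn : (n : ℝ) = q ^ 2 := (Real.sq_sqrt hn'.le).symm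
        rw [hqn, abs_mul, abs_of_pos (by positivity : 0 < (q ^ 2)⁻¹), abs_mul, abs_two]
        -- This trades `|S_n|` for `S_n²`, whose mean is known exactly to be `n s`.
        have key : 2 * |S n ω| * q ≤ S n ω ^ 2 + q ^ 2 := by
          rw [← sq_abs (S n ω)]
          nlinarith [sq_nonneg (|S n ω| - q)]
        have e : q⁻¹ * ((q ^ 2)⁻¹ * S n ω ^ 2 + 1) = (q ^ 2)⁻¹ * ((S n ω ^ 2 + q ^ 2) * q⁻¹) := by
          field_simp
        rw [e]
        refine mul_le_mul_of_nonneg_left ?_ (by positivity)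
        rw [← div_eq_mul_inv, le_div_iff₀ hq0]
        exact key
      have t3 : |(n : ℝ)⁻¹ * (n * ‖m‖ ^ 2)| ≤ (n : ℝ)⁻¹ * meanBound β ε V n ω := by
        rw [abs_of_nonneg (by positivity)]
        gcongr
      rw [hEq]
      exact (abs_sub _ _).trans (add_le_add ((abs_add_le _ _).trans (add_le_add t1 t2)) t3)
    · set C := 3 / (1 - β) ^ 2 * (2 * v2 + ∫ ω, ‖ε 0 ω‖ ^ 2 ∂P) with hC
      have hle : ∀ᶠ n : ℕ in atTop, ∫ ω, (c * ((n : ℝ)⁻¹ * (‖V 0 ω‖ ^ 2 + ‖V n ω‖ ^ 2)) +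
          c * ((√n)⁻¹ * ((n : ℝ)⁻¹ * S n ω ^ 2 + 1)) + (n : ℝ)⁻¹ * meanBound β ε V n ω) ∂P ≤
          c * ((n : ℝ)⁻¹ * (v2 + v2)) + c * ((√n)⁻¹ * (s + 1)) + (n : ℝ)⁻¹ * C := by
        filter_upwards [eventually_ne_atTop 0] with n hn
        have hn' : (n : ℝ) ≠ 0 := by exact_mod_cast hn
        rw [integral_add (hi3 n) ((h.integrable_meanBound n).const_mul _),
          integral_add (((hi1 n).const_mul _).const_mul _) (((hi2 n).const_mul _).const_mul _),
          integral_const_mul, integral_const_mul, integral_const_mul, integral_const_mul,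
          integral_const_mul, integral_add (h.integrable_norm_sq 0) (h.integrable_norm_sq n),
          integral_add ((h.memLp_sum_score n).integrable_sq.const_mul _) (integrable_const 1),
          integral_const_mul, h.integral_sum_score_sq, h.integral_norm_pow n, ← mul_assoc (n : ℝ)⁻¹ n,
          inv_mul_cancel₀ hn', one_mul]
        simp only [integral_const, probReal_univ, smul_eq_mul, one_mul]
        gcongr
        exact h.integral_meanBound_le hn
      have hlim : Tendsto (fun n : ℕ => c * ((n : ℝ)⁻¹ * (v2 + v2)) + c * ((√n)⁻¹ * (s + 1)) +
          (n : ℝ)⁻¹ * C) atTop (𝓝 0) := by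
        have h1 : Tendsto (fun n : ℕ => (√n)⁻¹) atTop (𝓝 0) :=
          tendsto_inv_atTop_zero.comp (Real.tendsto_sqrt_atTop.comp tendsto_natCast_atTop_atTop)
        have h2 : Tendsto (fun n : ℕ => (n : ℝ)⁻¹) atTop (𝓝 0) :=
          tendsto_inv_atTop_zero.comp tendsto_natCast_atTop_atTop
        simpa using (((h2.mul_const (v2 + v2)).const_mul c).add
          ((h1.mul_const (s + 1)).const_mul c)).add (h2.mul_const C)
      refine squeeze_zero' (Eventually.of_forall fun n => integral_nonneg fun ω => ?_) hle hlim
      have : 0 ≤ meanBound β ε V n ω := by unfold meanBound; positivity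
      positivity
  have := TendstoInMeasure.add_zero' hmain hrest
  simpa using this

/-- Asymptotic normality of the lag one empirical autocorrelation. -/
theorem tendstoInDistribution_empAutocorr (h : IsCausalAR P β ε V) (hβ : |β| < 1)
    (hpos : 0 < ∫ ω, ‖ε 0 ω‖ ^ 2 ∂P) :
    TendstoInDistribution (fun (n : ℕ) ω => √n *
      (empAutocov (fun t => V t ω) n 1 / empAutocov (fun t => V t ω) n 0 - β)) atTop (id : ℝ → ℝ)
      (fun _ => P) (gaussianReal 0 ((∫ ω, inner ℝ (ε 0 ω) (ε 1 ω) ^ 2 ∂P) /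
        (∫ ω, ‖ε 0 ω‖ ^ 2 ∂P) ^ 2 * (1 - β ^ 2)).toNNReal) := by
  have hβ2 : 0 < 1 - β ^ 2 := by
    have := (sq_lt_one_iff_abs_lt_one β).2 hβ
    linarith
  have hv := h.one_sub_sq_mul_integral_norm_sq
  have hs := h.one_sub_sq_mul_integral_score_sq
  have hvpos : 0 < ∫ ω, ‖V 0 ω‖ ^ 2 ∂P := by
    rw [← hv] at hpos
    exact pos_of_mul_pos_right hpos hβ2.le
  -- The numerator yields one factor `1 - β²`, the squared denominator two; the explicit factor
  -- cancels the excess.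
  have hvar : (∫ ω, inner ℝ (ε 0 ω) (ε 1 ω) ^ 2 ∂P) / (∫ ω, ‖ε 0 ω‖ ^ 2 ∂P) ^ 2 * (1 - β ^ 2) =
      (∫ ω, score ε V 0 ω ^ 2 ∂P) / (∫ ω, ‖V 0 ω‖ ^ 2 ∂P) ^ 2 := by
    rw [← hv, ← hs]
    field_simp
  rw [hvar]
  have hs0 : 0 ≤ ∫ ω, score ε V 0 ω ^ 2 ∂P := integral_nonneg fun _ => sq_nonneg _
  have hS : ∀ n : ℕ, Measurable fun ω => ∑ k ∈ Finset.range n, score ε V (k : ℤ) ω := fun n =>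
    Finset.measurable_fun_sum _ fun k _ => h.measurable_score k
  have h1 := h.tendstoInDistribution_sum_score hβ
  have h2 := h.tendstoInMeasure_remainder hβ
  have h3 := h.tendstoInMeasure_empAutocov_zero_div hβ
  have h4 := fun n => h.measurable_empAutocov n 1
  have h5 := fun n => h.measurable_empAutocov n 0
  exact tendstoInDistribution_sqrt_mul_div_sub
    (N := fun n ω => empAutocov (fun t => V t ω) n 1) (D := fun n ω => empAutocov (fun t => V t ω) n 0)
    (S := fun n ω => ∑ k ∈ Finset.range n, score ε V (k : ℤ) ω) hvpos hs0 h4 h5 hS h1 h2 h3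

end IsCausalAR

end RatioCLT

/-! ### Stationary solutions are causal and inherit the moments of the noise. -/

section Causality

lemma stronglyMeasurable_limUnder_atTop {Ω H : Type*} {m : MeasurableSpace Ω} [NormedAddCommGroup H]
    [CompleteSpace H] {f : ℕ → Ω → H} (hf : ∀ i, StronglyMeasurable (f i)) :
    StronglyMeasurable (fun ω => limUnder atTop (fun i => f i ω)) :=
  StronglyMeasurable.limUnder hf

variable {Ω : Type*} {mΩ : MeasurableSpace Ω} {P : Measure Ω} [IsProbabilityMeasure P]
variable {H : Type*} [NormedAddCommGroup H] [InnerProductSpace ℝ H] [CompleteSpace H]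
  [SecondCountableTopology H] [MeasurableSpace H] [BorelSpace H] {β : ℝ} {ε V : ℤ → Ω → H}

/-- The gap is `β^m V_{t-m}`, which by stationarity has the law of `β^m V_0`, and the latter tends
to zero pointwise. No moment of `V` is used. -/
lemma tendstoInMeasure_partialSum (hβ : |β| < 1) (hV : ∀ t, IdentDistrib (V t) (V 0) P P)
    (heq : ∀ t, ∀ᵐ ω ∂P, V t ω = β • V (t - 1) ω + ε t ω) (t : ℤ) :
    TendstoInMeasure P (fun (m : ℕ) ω => ∑ j ∈ Finset.range m, β ^ j • ε (t - j) ω) atTop (V t) := by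
  have h0 : TendstoInMeasure P (fun (m : ℕ) ω => β ^ m • V 0 ω) atTop (fun _ => 0) := by
    refine tendstoInMeasure_of_tendsto_ae
      (fun m => (hV 0).aemeasurable_snd.aestronglyMeasurable.const_smul _) (ae_of_all _ fun ω => ?_)
    simpa using (tendsto_pow_atTop_nhds_zero_of_abs_lt_one hβ).smul_const (V 0 ω)
  rw [tendstoInMeasure_iff_norm] at h0 ⊢
  intro η hη
  refine (h0 η hη).congr fun m => ?_
  have h1 : P {ω | η ≤ ‖β ^ m • V (t - m) ω‖} = P {ω | η ≤ ‖β ^ m • V 0 ω‖} :=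
    (hV (t - m)).measure_mem_eq (s := {x | η ≤ ‖β ^ m • x‖})
      (measurableSet_le measurable_const (by fun_prop))
  simp only [sub_zero]
  rw [← h1]
  refine measure_congr ?_
  filter_upwards [ae_eq_iterate heq t m] with ω hω
  refine propext (iff_of_eq (congrArg (η ≤ ·) ?_))
  rw [hω, sub_add_cancel_right, norm_neg]

/-- A strictly stationary solution of the autoregressive equation is almost surely equal to a
causal one. -/
theorem exists_isCausalAR (hβ : |β| < 1) (hind : iIndepFun ε P)
    (hε : ∀ t, IdentDistrib (ε t) (ε 0) P P) (hL : MemLp (ε 0) 3 P) (h0 : ∫ ω, ε 0 ω ∂P = 0)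
    (hV : ∀ t, IdentDistrib (V t) (V 0) P P)
    (heq : ∀ t, ∀ᵐ ω ∂P, V t ω = β • V (t - 1) ω + ε t ω) :
    ∃ ε' V' : ℤ → Ω → H, IsCausalAR P β ε' V' ∧ (∀ t, ε t =ᵐ[P] ε' t) ∧ ∀ t, V t =ᵐ[P] V' t := by
  set ε' : ℤ → Ω → H := fun t => (hε t).aemeasurable_fst.mk (ε t) with hε'
  have hm : ∀ t, Measurable (ε' t) := fun t => (hε t).aemeasurable_fst.measurable_mk
  have hae : ∀ t, ε t =ᵐ[P] ε' t := fun t => (hε t).aemeasurable_fst.ae_eq_mk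
  have heq' : ∀ t, ∀ᵐ ω ∂P, V t ω = β • V (t - 1) ω + ε' t ω := fun t => by
    filter_upwards [heq t, hae t] with ω h1 h2
    rw [h1, h2]
  have hid : ∀ t, IdentDistrib (ε' t) (ε 0) P P := fun t =>
    (IdentDistrib.of_ae_eq (hm t).aemeasurable (hae t).symm).trans (hε t)
  have hLp : ∀ t, MemLp (ε' t) 3 P := fun t => (hid t).memLp_iff.2 hL
  have hWm : ∀ (t : ℤ) (m : ℕ), Measurable[block ε' (Set.Iic t)]
      (fun ω => ∑ j ∈ Finset.range m, β ^ j • ε' (t - j) ω) := fun t m =>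
    Finset.measurable_fun_sum _ fun j _ =>
      (measurable_block ε' (S := Set.Iic t) (t := t - j) (by simp)).const_smul _
  have hVm : ∀ t, AEStronglyMeasurable[block ε' (Set.Iic t)] (V t) P := fun t => by
    -- An almost sure limit along a subsequence of functions of `ε'_s`, `s ≤ t`, is again a function
    -- of that past up to null sets.
    obtain ⟨ns, -, hns⟩ := (tendstoInMeasure_partialSum hβ hV heq' t).exists_seq_tendsto_ae
    refine ⟨_, stronglyMeasurable_limUnder_atTop fun i => (hWm t (ns i)).stronglyMeasurable, ?_⟩
    filter_upwards [hns] with ω hω using hω.limUnder_eq.symm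
  have hVL : MemLp (V 0) 3 P := by
    refine ⟨(hV 0).aemeasurable_snd.aestronglyMeasurable, ?_⟩
    -- The geometric series bounds the partial sums in `L³` uniformly in `m`; the bound survives the
    -- limit in probability.
    have hb : ∀ m : ℕ, eLpNorm (fun ω => ∑ j ∈ Finset.range m, β ^ j • ε' (0 - j) ω) 3 P ≤
        ENNReal.ofReal ((1 - |β|)⁻¹) * eLpNorm (ε 0) 3 P := by
      intro m
      calc eLpNorm (fun ω => ∑ j ∈ Finset.range m, β ^ j • ε' (0 - j) ω) 3 P
          = eLpNorm (∑ j ∈ Finset.range m, β ^ j • ε' (0 - j)) 3 P := by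
            congr 1
            ext ω
            simp
        _ ≤ ∑ j ∈ Finset.range m, eLpNorm (β ^ j • ε' (0 - j)) 3 P :=
            eLpNorm_sum_le (fun j _ => (hLp _).aestronglyMeasurable.const_smul _) (by norm_num)
        _ = ∑ j ∈ Finset.range m, ENNReal.ofReal (|β| ^ j) * eLpNorm (ε 0) 3 P := by
            refine Finset.sum_congr rfl fun j _ => ?_
            rw [eLpNorm_const_smul, (hid _).eLpNorm_eq, ← abs_pow, Real.enorm_eq_ofReal_abs]
        _ = ENNReal.ofReal (∑ j ∈ Finset.range m, |β| ^ j) * eLpNorm (ε 0) 3 P := by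
            rw [← Finset.sum_mul, ENNReal.ofReal_sum_of_nonneg fun j _ => by positivity]
        _ ≤ _ := by
            gcongr
            rw [← tsum_geometric_of_lt_one (abs_nonneg β) hβ]
            exact (summable_geometric_of_lt_one (abs_nonneg β) hβ).sum_le_tsum _
              fun j _ => by positivity
    refine lt_of_le_of_lt (eLpNorm_le_of_tendstoInMeasure (Eventually.of_forall hb)
      (tendstoInMeasure_partialSum hβ hV heq' 0)
      (fun m => ((hWm 0 m).mono (block_le hm _) le_rfl).aestronglyMeasurable)) ?_
    exact ENNReal.mul_lt_top ENNReal.ofReal_lt_top hL.2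
  have hVae : ∀ t, V t =ᵐ[P] (hVm t).mk (V t) := fun t => (hVm t).ae_eq_mk
  have hVmk : ∀ t, Measurable[block ε' (Set.Iic t)] ((hVm t).mk (V t)) := fun t =>
    (hVm t).stronglyMeasurable_mk.measurable
  have hVid : ∀ t, IdentDistrib ((hVm t).mk (V t)) (V t) P P := fun t =>
    IdentDistrib.of_ae_eq ((hVmk t).mono (block_le hm _) le_rfl).aemeasurable (hVae t).symm
  refine ⟨ε', fun t => (hVm t).mk (V t), ?_, hae, hVae⟩
  exact
    { measurable_noise := hm
      indep := hind.congr hae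
      identDistrib_noise := fun t => (hid t).trans (hid 0).symm
      memLp_noise_zero := hLp 0
      integral_noise_zero := by rw [(hid 0).integral_eq, h0]
      measurable_block := hVmk
      identDistrib := fun t => ((hVid t).trans (hV t)).trans (hVid 0).symm
      memLp_zero := (hVid 0).memLp_iff.2 hVL
      equation := fun t => by
        filter_upwards [heq' t, hVae t, hVae (t - 1)] with ω h1 h2 h3
        rw [← h2, ← h3, h1] }

end Causality

/-! ### Passage from functions to their classes in `L²(μ)`. -/

section RandomElements

lemma toL2_of_memLp {μ : Measure ℝ} {g : ℝ → ℝ} (hg : MemLp g 2 μ) : toL2 μ g = hg.toLp g :=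
  dif_pos hg

lemma toL2_ae_eq {μ : Measure ℝ} {g : ℝ → ℝ} (hg : MemLp g 2 μ) : toL2 μ g =ᵐ[μ] g := by
  rw [toL2_of_memLp hg]
  exact hg.coeFn_toLp

lemma inner_toL2 {μ : Measure ℝ} {g h : ℝ → ℝ} (hg : MemLp g 2 μ) (hh : MemLp h 2 μ) :
    inner ℝ (toL2 μ g) (toL2 μ h) = ∫ u, g u * h u ∂μ := by
  rw [L2.inner_def]
  refine integral_congr_ae ?_
  filter_upwards [toL2_ae_eq hg, toL2_ae_eq hh] with u h1 h2
  rw [h1, h2]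
  simp [mul_comm]

lemma norm_toL2_sq {μ : Measure ℝ} {g : ℝ → ℝ} (hg : MemLp g 2 μ) :
    ‖toL2 μ g‖ ^ 2 = ∫ u, g u ^ 2 ∂μ := by
  rw [← real_inner_self_eq_norm_sq, inner_toL2 hg hg]
  simp only [sq]

lemma toL2_congr {μ : Measure ℝ} {g h : ℝ → ℝ} (hgh : g =ᵐ[μ] h) : toL2 μ g = toL2 μ h := by
  by_cases hg : MemLp g 2 μ
  · have hh : MemLp h 2 μ := (memLp_congr_ae hgh).1 hg
    rw [toL2_of_memLp hg, toL2_of_memLp hh]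
    exact (MemLp.toLp_eq_toLp_iff hg hh).2 hgh
  · have hh : ¬ MemLp h 2 μ := fun h' => hg ((memLp_congr_ae hgh).2 h')
    simp [toL2, hg, hh]

lemma toL2_add {μ : Measure ℝ} {g h : ℝ → ℝ} (hg : MemLp g 2 μ) (hh : MemLp h 2 μ) :
    toL2 μ (fun u => g u + h u) = toL2 μ g + toL2 μ h := by
  rw [toL2_of_memLp hg, toL2_of_memLp hh, ← MemLp.toLp_add]
  exact toL2_of_memLp (hg.add hh)

lemma toL2_sub {μ : Measure ℝ} {g h : ℝ → ℝ} (hg : MemLp g 2 μ) (hh : MemLp h 2 μ) :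
    toL2 μ (fun u => g u - h u) = toL2 μ g - toL2 μ h := by
  rw [toL2_of_memLp hg, toL2_of_memLp hh, ← MemLp.toLp_sub]
  exact toL2_of_memLp (hg.sub hh)

lemma toL2_const_mul {μ : Measure ℝ} {g : ℝ → ℝ} (hg : MemLp g 2 μ) (c : ℝ) :
    toL2 μ (fun u => c * g u) = c • toL2 μ g := by
  rw [toL2_of_memLp hg, ← MemLp.toLp_const_smul]
  exact toL2_of_memLp (hg.const_smul c)

lemma toL2_sum {μ : Measure ℝ} {ι : Type*} (s : Finset ι) {g : ι → ℝ → ℝ}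
    (hg : ∀ i, MemLp (g i) 2 μ) : toL2 μ (fun u => ∑ i ∈ s, g i u) = ∑ i ∈ s, toL2 μ (g i) := by
  classical
  induction s using Finset.induction_on with
  | empty =>
    simp only [Finset.sum_empty]
    have h0 : MemLp (fun _ : ℝ => (0 : ℝ)) 2 μ := MemLp.zero'
    rw [toL2_of_memLp h0]
    exact MemLp.toLp_zero h0
  | insert i s hi ih =>
    simp only [Finset.sum_insert hi]
    rw [toL2_add (hg i) (memLp_finsetSum s fun j _ => hg j), ih]

lemma memLp_meanMap {μ : Measure ℝ} {v : ℤ → ℝ → ℝ} (hv : ∀ t, MemLp (v t) 2 μ) (n : ℕ) :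
    MemLp (meanMap v n) 2 μ :=
  (memLp_finsetSum _ fun t _ => hv t).const_mul _

lemma empMean_toL2 {μ : Measure ℝ} {v : ℤ → ℝ → ℝ} (hv : ∀ t, MemLp (v t) 2 μ) (n : ℕ) :
    empMean (fun t => toL2 μ (v t)) n = toL2 μ (meanMap v n) := by
  unfold empMean meanMap
  rw [toL2_const_mul (memLp_finsetSum _ fun t _ => hv t), toL2_sum _ hv]

lemma empAutocov_toL2 {μ : Measure ℝ} {v : ℤ → ℝ → ℝ} (hv : ∀ t, MemLp (v t) 2 μ) (n h : ℕ) :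
    empAutocov (fun t => toL2 μ (v t)) n h = ∫ u, ∑ t ∈ Finset.Icc (1 : ℤ) ((n : ℤ) - h),
      (v t u - meanMap v n u) * (v (t + h) u - meanMap v n u) ∂μ := by
  have hm := memLp_meanMap hv n
  have hi : ∀ t, Integrable
      (fun u => (v t u - meanMap v n u) * (v (t + h) u - meanMap v n u)) μ :=
    fun t => ((hv t).sub hm).integrable_mul ((hv (t + h)).sub hm)
  rw [integral_finsetSum _ fun t _ => hi t]
  refine Finset.sum_congr rfl fun t _ => ?_
  rw [empMean_toL2 hv, ← toL2_sub (hv t) hm, ← toL2_sub (hv _) hm]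
  exact inner_toL2 ((hv t).sub hm) ((hv _).sub hm)

/-- The estimator of the autoregressive parameter is the empirical lag one autocorrelation of the
tangent vectors. -/
lemma betaHat_eq {Ω : Type*} [MeasurableSpace Ω] {μ : Measure ℝ} [IsProbabilityMeasure μ]
    (hμ : μ ≪ volume) (hS : μ.support.OrdConnected) {V : ℤ → Ω → ℝ → ℝ} {ω : Ω}
    (hv : ∀ t, Measurable (V t ω))
    (hd : ∀ t, ∀ u ∈ μ.support, DifferentiableWithinAt ℝ (V t ω) μ.support u ∧
      -1 < derivWithin (V t ω) μ.support u) (hL : ∀ t, MemLp (V t ω) 2 μ) (n : ℕ) :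
    betaHat μ V n ω = empAutocov (fun t => toL2 μ (V t ω)) n 1 /
      empAutocov (fun t => toL2 μ (V t ω)) n 0 := by
  -- For `n = 0` both ratios are `0 / 0 = 0`.
  rcases eq_or_ne n 0 with rfl | hn
  · simp [betaHat, estAutocorr, estAutocov, empAutocov]
  · have key : ∀ h : ℕ, ∫ u, estAutocov (fun t => quantile (expMap μ (V t ω))) n h u *
        meanDens (fun t => quantile (expMap μ (V t ω))) n u =
        (n : ℝ)⁻¹ * empAutocov (fun t => toL2 μ (V t ω)) n h := fun h => by
      rw [integral_estAutocov_quantile_expMap hμ hS hv hd hn, integral_const_mul,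
        empAutocov_toL2 hL]
    have hn' : (n : ℝ)⁻¹ ≠ 0 := inv_ne_zero (by exact_mod_cast hn)
    rw [betaHat, estAutocorr, key, key, mul_div_mul_left _ _ hn']

end RandomElements

/-! ### Moments of the random elements in terms of the covariance kernel. -/

section Covariance

variable {Ω : Type*} {mΩ : MeasurableSpace Ω} {P : Measure Ω} [IsProbabilityMeasure P]
  {μ : Measure ℝ} [IsProbabilityMeasure μ] {X : Ω → ℝ → ℝ}

lemma memLp_uncurry_of_lintegral (hX : Measurable (Function.uncurry X))
    (h4 : ∫⁻ u, ∫⁻ ω, ENNReal.ofReal (X ω u ^ 4) ∂P ∂μ < ∞) :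
    MemLp (Function.uncurry X) 4 (P.prod μ) := by
  have hm : Measurable fun p : Ω × ℝ => ENNReal.ofReal (Function.uncurry X p ^ 4) := by fun_prop
  have hint : Integrable (fun p => ‖Function.uncurry X p‖ ^ 4) (P.prod μ) := by
    refine ⟨by fun_prop, ?_⟩
    rw [hasFiniteIntegral_iff_ofReal (ae_of_all _ fun p => by positivity)]
    have he : ∀ p, ‖Function.uncurry X p‖ ^ 4 = Function.uncurry X p ^ 4 := fun p => by
      rw [Real.norm_eq_abs]
      exact Even.pow_abs (by decide) _
    simp only [he]
    rw [lintegral_prod_symm _ hm.aemeasurable]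
    exact h4
  rw [← integrable_norm_rpow_iff hX.aestronglyMeasurable (by norm_num) (by norm_num)]
  refine hint.congr (ae_of_all _ fun p => ?_)
  simp only [ENNReal.toReal_ofNat]
  norm_cast

lemma integrable_pow_four (h4 : MemLp (Function.uncurry X) 4 (P.prod μ)) :
    Integrable (fun p : Ω × ℝ => X p.1 p.2 ^ 4) (P.prod μ) := by
  have := h4.integrable_norm_pow (p := 4) (by norm_num)
  refine this.congr (ae_of_all _ fun p => ?_)
  simp only [Real.norm_eq_abs]
  exact Even.pow_abs (by decide) _

lemma integrable_sq_prod (h4 : MemLp (Function.uncurry X) 4 (P.prod μ)) :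
    Integrable (fun p : Ω × ℝ => X p.1 p.2 ^ 2) (P.prod μ) :=
  (h4.mono_exponent (by norm_num : (2 : ℝ≥0∞) ≤ 4)).integrable_sq

lemma ae_memLp_two (hX : Measurable (Function.uncurry X))
    (h4 : MemLp (Function.uncurry X) 4 (P.prod μ)) : ∀ᵐ ω ∂P, MemLp (X ω) 2 μ := by
  filter_upwards [(integrable_sq_prod h4).prod_right_ae] with ω hω
  exact (memLp_two_iff_integrable_sq hX.of_uncurry_left.aestronglyMeasurable).2 hω

lemma sq_integral_le {g : ℝ → ℝ} (hg : Integrable g μ) (hg2 : Integrable (fun u => g u ^ 2) μ) :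
    (∫ u, g u ∂μ) ^ 2 ≤ ∫ u, g u ^ 2 ∂μ := by
  have hL : MemLp g 2 μ := (memLp_two_iff_integrable_sq hg.aestronglyMeasurable).2 hg2
  have := variance_nonneg g μ
  rw [variance_eq_sub hL] at this
  simp only [Pi.pow_apply] at this
  linarith

/-- As `μ` is a probability measure, Jensen gives `‖X‖⁴ = (∫ X² dμ)² ≤ ∫ X⁴ dμ`. -/
lemma memLp_toL2 (hX : Measurable (Function.uncurry X))
    (h4 : MemLp (Function.uncurry X) 4 (P.prod μ))
    (hm : AEStronglyMeasurable (fun ω => toL2 μ (X ω)) P) :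
    MemLp (fun ω => toL2 μ (X ω)) 4 P := by
  rw [← integrable_norm_rpow_iff hm (by norm_num) (by norm_num)]
  refine (integrable_pow_four h4).integral_prod_left.mono'
    (by simp only [ENNReal.toReal_ofNat]; exact (hm.norm.aemeasurable.pow_const _).aestronglyMeasurable) ?_
  filter_upwards [ae_memLp_two hX h4, (integrable_pow_four h4).prod_right_ae] with ω h1 h2
  have h3 : ‖toL2 μ (X ω)‖ ^ 4 ≤ ∫ u, X ω u ^ 4 ∂μ := by
    have e : ‖toL2 μ (X ω)‖ ^ 4 = (∫ u, X ω u ^ 2 ∂μ) ^ 2 := by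
      rw [← norm_toL2_sq h1]
      ring
    rw [e]
    have h5 : (fun u => X ω u ^ 4) = fun u => (X ω u ^ 2) ^ 2 := by
      funext u
      ring
    rw [h5] at h2 ⊢
    exact sq_integral_le h1.integrable_sq h2
  have h6 : ‖toL2 μ (X ω)‖ ^ ((4 : ℝ≥0∞).toReal) = ‖toL2 μ (X ω)‖ ^ 4 := by
    simp only [ENNReal.toReal_ofNat]
    norm_cast
  rw [h6, Real.norm_eq_abs, abs_of_nonneg (by positivity)]
  exact h3

/-- Testing the Bochner integral against each element of `L²(μ)` and applying Fubini reduces it to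
the pointwise means. -/
lemma integral_toL2_eq_zero (hX : Measurable (Function.uncurry X))
    (h4 : MemLp (Function.uncurry X) 4 (P.prod μ))
    (hm : AEStronglyMeasurable (fun ω => toL2 μ (X ω)) P)
    (h0 : ∀ᵐ u ∂μ, ∫ ω, X ω u ∂P = 0) : ∫ ω, toL2 μ (X ω) ∂P = 0 := by
  have hi : Integrable (fun ω => toL2 μ (X ω)) P := (memLp_toL2 hX h4 hm).integrable (by norm_num)
  refine ext_inner_left ℝ fun h => ?_
  rw [inner_zero_right, ← integral_inner hi]
  have hhL : MemLp h 2 μ := Lp.memLp h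
  have hh : toL2 μ h = h := by
    rw [toL2_of_memLp hhL]
    exact Lp.toLp_coeFn h hhL
  have hint : Integrable (Function.uncurry fun ω u => h u * X ω u) (P.prod μ) :=
    (hhL.comp_measurePreserving (measurePreserving_snd (μ := P))).integrable_mul
      (h4.mono_exponent (by norm_num : (2 : ℝ≥0∞) ≤ 4))
  calc ∫ ω, inner ℝ h (toL2 μ (X ω)) ∂P = ∫ ω, ∫ u, h u * X ω u ∂μ ∂P := by
        refine integral_congr_ae ?_
        filter_upwards [ae_memLp_two hX h4] with ω hω
        conv_lhs => rw [← hh]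
        exact inner_toL2 hhL hω
    _ = ∫ u, ∫ ω, h u * X ω u ∂P ∂μ := integral_integral_swap hint
    _ = 0 := by
        refine integral_eq_zero_of_ae ?_
        filter_upwards [h0] with u hu
        rw [integral_const_mul, hu, mul_zero, Pi.zero_apply]

lemma integral_norm_toL2_sq (hX : Measurable (Function.uncurry X))
    (h4 : MemLp (Function.uncurry X) 4 (P.prod μ)) (h0 : ∀ᵐ u ∂μ, ∫ ω, X ω u ∂P = 0) :
    ∫ ω, ‖toL2 μ (X ω)‖ ^ 2 ∂P = ∫ u, covariance (fun ω => X ω u) (fun ω => X ω u) P ∂μ := by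
  calc ∫ ω, ‖toL2 μ (X ω)‖ ^ 2 ∂P = ∫ ω, ∫ u, X ω u ^ 2 ∂μ ∂P := by
        refine integral_congr_ae ?_
        filter_upwards [ae_memLp_two hX h4] with ω hω using norm_toL2_sq hω
    _ = ∫ u, ∫ ω, X ω u ^ 2 ∂P ∂μ := integral_integral_swap (integrable_sq_prod h4)
    _ = _ := by
        refine integral_congr_ae ?_
        filter_upwards [h0] with u hu
        simp only [covariance, hu, sub_zero, sq]

/-- Each of the four factors is the `L⁴` function `X` composed with a measure-preserving projection.
This integrability gives both finiteness of `∬ C²` and the Fubini exchange. -/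
lemma integrable_fourfold (h4 : MemLp (Function.uncurry X) 4 (P.prod μ)) :
    Integrable (fun q : (Ω × Ω) × (ℝ × ℝ) =>
      (X q.1.1 q.2.1 * X q.1.2 q.2.1) * (X q.1.1 q.2.2 * X q.1.2 q.2.2))
      ((P.prod P).prod (μ.prod μ)) := by
  have hproj : ∀ {a : Ω × Ω → Ω} {b : ℝ × ℝ → ℝ}, MeasurePreserving a (P.prod P) P →
      MeasurePreserving b (μ.prod μ) μ →
      MemLp (fun q : (Ω × Ω) × (ℝ × ℝ) => X (a q.1) (b q.2)) 4 ((P.prod P).prod (μ.prod μ)) :=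
    fun ha hb => h4.comp_measurePreserving (ha.prod hb)
  have m1 := hproj measurePreserving_fst measurePreserving_fst
  have m2 := hproj measurePreserving_snd measurePreserving_fst
  have m3 := hproj measurePreserving_fst measurePreserving_snd
  have m4 := hproj measurePreserving_snd measurePreserving_snd
  have i : ∀ {g : (Ω × Ω) × (ℝ × ℝ) → ℝ}, MemLp g 4 ((P.prod P).prod (μ.prod μ)) →
      Integrable (fun q => g q ^ 4) ((P.prod P).prod (μ.prod μ)) := fun {g} hg => by
    refine (hg.integrable_norm_pow (p := 4) (by norm_num)).congr (ae_of_all _ fun q => ?_)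
    simp only [Real.norm_eq_abs]
    exact Even.pow_abs (by decide) _
  refine (((i m1).add (i m2)).add ((i m3).add (i m4))).mono'
    ((m1.aestronglyMeasurable.mul m2.aestronglyMeasurable).mul
      (m3.aestronglyMeasurable.mul m4.aestronglyMeasurable)) (ae_of_all _ fun q => ?_)
  have key : ∀ a b c d : ℝ, |a * b * (c * d)| ≤ a ^ 4 + b ^ 4 + (c ^ 4 + d ^ 4) := by
    intro a b c d
    rw [abs_le]
    constructor <;>
    nlinarith [sq_nonneg (a * b + c * d), sq_nonneg (a * b - c * d), sq_nonneg (a ^ 2 - b ^ 2),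
      sq_nonneg (c ^ 2 - d ^ 2), sq_nonneg (a ^ 2 + b ^ 2), sq_nonneg (c ^ 2 + d ^ 2)]
  exact key _ _ _ _

/-- The square of an expectation is an expectation over two independent copies; the factors are
grouped as they occur in `⟨X, X'⟩²`. -/
lemma covariance_ae_eq (h0 : ∀ᵐ u ∂μ, ∫ ω, X ω u ∂P = 0) :
    ∀ᵐ p ∂(μ.prod μ), covariance (fun ω => X ω p.1) (fun ω => X ω p.2) P ^ 2 =
      ∫ w : Ω × Ω, (X w.1 p.1 * X w.2 p.1) * (X w.1 p.2 * X w.2 p.2) ∂(P.prod P) := by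
  filter_upwards [measurePreserving_fst.quasiMeasurePreserving.ae h0,
    measurePreserving_snd.quasiMeasurePreserving.ae h0] with p h1 h2
  simp only [covariance, h1, h2, sub_zero]
  rw [sq, ← integral_prod_mul]
  refine integral_congr_ae (ae_of_all _ fun w => ?_)
  simp only
  ring

lemma integrable_covariance_sq (h4 : MemLp (Function.uncurry X) 4 (P.prod μ))
    (h0 : ∀ᵐ u ∂μ, ∫ ω, X ω u ∂P = 0) :
    Integrable (fun p : ℝ × ℝ => covariance (fun ω => X ω p.1) (fun ω => X ω p.2) P ^ 2)
      (μ.prod μ) :=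
  (integrable_fourfold h4).integral_prod_right.congr
    ((covariance_ae_eq h0).mono fun _ hp => hp.symm)

lemma integral_inner_toL2_sq (hX : Measurable (Function.uncurry X))
    (h4 : MemLp (Function.uncurry X) 4 (P.prod μ)) (h0 : ∀ᵐ u ∂μ, ∫ ω, X ω u ∂P = 0) :
    ∫ w : Ω × Ω, inner ℝ (toL2 μ (X w.1)) (toL2 μ (X w.2)) ^ 2 ∂(P.prod P) =
      ∫ p, covariance (fun ω => X ω p.1) (fun ω => X ω p.2) P ^ 2 ∂(μ.prod μ) := by
  have hae := ae_memLp_two hX h4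
  calc _ = ∫ w : Ω × Ω, ∫ p : ℝ × ℝ, (X w.1 p.1 * X w.2 p.1) * (X w.1 p.2 * X w.2 p.2)
        ∂(μ.prod μ) ∂(P.prod P) := by
        refine integral_congr_ae ?_
        filter_upwards [measurePreserving_fst.quasiMeasurePreserving.ae hae,
          measurePreserving_snd.quasiMeasurePreserving.ae hae] with w h1 h2
        rw [inner_toL2 h1 h2, sq, ← integral_prod_mul]
    _ = ∫ p : ℝ × ℝ, ∫ w : Ω × Ω, (X w.1 p.1 * X w.2 p.1) * (X w.1 p.2 * X w.2 p.2)
        ∂(P.prod P) ∂(μ.prod μ) := integral_integral_swap (integrable_fourfold h4)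
    _ = _ := integral_congr_ae ((covariance_ae_eq h0).mono fun _ hp => hp.symm)

end Covariance

/-- The law of `(X, Y)` is that of two independent copies of `X` realized on `Ω × Ω`, the form in
which Fubini applies. -/
lemma integral_inner_sq_of_indepFun {Ω H : Type*} [MeasurableSpace Ω] {P : Measure Ω}
    [IsProbabilityMeasure P] [NormedAddCommGroup H] [InnerProductSpace ℝ H]
    [SecondCountableTopology H] [MeasurableSpace H] [BorelSpace H] {X Y : Ω → H}
    (hXY : IndepFun X Y P) (h : IdentDistrib Y X P P) :
    ∫ ω, inner ℝ (X ω) (Y ω) ^ 2 ∂P = ∫ w : Ω × Ω, inner ℝ (X w.1) (X w.2) ^ 2 ∂(P.prod P) := by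
  have hX : AEMeasurable X P := h.aemeasurable_snd
  have h1 : IdentDistrib X (fun w : Ω × Ω => X w.1) P (P.prod P) :=
    ⟨hX, hX.comp_fst, by
      have : AEMeasurable X ((P.prod P).map Prod.fst) := by
        rwa [measurePreserving_fst.map_eq]
      have e := AEMeasurable.map_map_of_aemeasurable this measurable_fst.aemeasurable
      rw [measurePreserving_fst.map_eq] at e
      exact e⟩
  have h2 : IdentDistrib X (fun w : Ω × Ω => X w.2) P (P.prod P) :=
    ⟨hX, hX.comp_snd, by
      have : AEMeasurable X ((P.prod P).map Prod.snd) := by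
        rwa [measurePreserving_snd.map_eq]
      have e := AEMeasurable.map_map_of_aemeasurable this measurable_snd.aemeasurable
      rw [measurePreserving_snd.map_eq] at e
      exact e⟩
  have hp := h1.prodMk (h.trans h2) hXY (indepFun_prod₀ hX hX)
  have hg : Measurable fun p : H × H => inner ℝ p.1 p.2 ^ 2 := by fun_prop
  exact (hp.comp hg).integral_eq

end WAR

end

/-! ### Assembly. -/

theorem theorem2 {Ω : Type*} [MeasurableSpace Ω] (P : Measure Ω) [IsProbabilityMeasure P]
    (f : ℝ → ℝ) (hf : WAR.IsDensity f)
    (hsupp : (WAR.densMeasure f).support.OrdConnected)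
    (β : ℝ) (ε V : ℤ → Ω → ℝ → ℝ)
    (hA1 : |β| < 1)
    (hA2 : WAR.IsInnovation P (WAR.densMeasure f) ε)
    (hpos : 0 < ∫ u, WAR.innovCov P ε u u ∂(WAR.densMeasure f))
    (hV : WAR.IsStationarySolution P (WAR.densMeasure f) β ε V)
    (hA3 : WAR.HasIncreasingTransport P (WAR.densMeasure f) V)
    (hA4 : WAR.HasFourthMoment P (WAR.densMeasure f) ε) :
    Integrable (fun p : ℝ × ℝ => WAR.innovCov P ε p.1 p.2 ^ 2)
        ((WAR.densMeasure f).prod (WAR.densMeasure f)) ∧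
      TendstoInDistribution
        (fun (n : ℕ) (ω : Ω) => Real.sqrt n * (WAR.betaHat (WAR.densMeasure f) V n ω - β))
        atTop (id : ℝ → ℝ) (fun _ => P)
        (gaussianReal 0 (WAR.sigmaSq P (WAR.densMeasure f) ε * (1 - β ^ 2)).toNNReal) := by
  have hμ : WAR.densMeasure f ≪ volume := withDensity_absolutelyContinuous _ _
  have : IsProbabilityMeasure (WAR.densMeasure f) := hf.2.2.1
  generalize WAR.densMeasure f = μ at *
  have : Fact ((2 : ℝ≥0∞) ≠ ∞) := ⟨by norm_num⟩
  have hεm := hA2.tangent.measurable 0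
  have h4 := WAR.memLp_uncurry_of_lintegral hεm (hA4 0)
  have h0 := hA2.mean_zero 0
  refine ⟨WAR.integrable_covariance_sq h4 h0, ?_⟩
  have hE : AEMeasurable (fun ω => WAR.toL2 μ (ε 0 ω)) P :=
    (hA2.identDistrib 0).aemeasurable_fst
  have hEL := WAR.memLp_toL2 hεm h4 hE.aestronglyMeasurable
  have hstat : ∀ t, IdentDistrib (fun ω => WAR.toL2 μ (V t ω)) (fun ω => WAR.toL2 μ (V 0 ω)) P P :=
    fun t => by
      -- Stationarity of the one-point laws under the shift by `-t`.
      have := (hV.stationary 1 (fun _ => t) (-t)).comp (measurable_pi_apply 0)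
      simpa [Function.comp_def] using this
  have heq : ∀ t, ∀ᵐ ω ∂P, WAR.toL2 μ (V t ω) =
      β • WAR.toL2 μ (V (t - 1) ω) + WAR.toL2 μ (ε t ω) := fun t => by
    filter_upwards [hV.equation t, hV.tangent.mem_tangent (t - 1), hA2.tangent.mem_tangent t]
      with ω h1 ⟨h2, _⟩ ⟨h3, _⟩
    rw [WAR.toL2_congr h1, WAR.toL2_add (h2.const_mul β) h3, WAR.toL2_const_mul h2]
  obtain ⟨ε', V', hAR, hε', hV'⟩ := WAR.exists_isCausalAR hA1 hA2.indep hA2.identDistrib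
    (hEL.mono_exponent (by norm_num)) (WAR.integral_toL2_eq_zero hεm h4 hE.aestronglyMeasurable h0)
    hstat heq
  have hden : ∫ ω, ‖ε' 0 ω‖ ^ 2 ∂P = ∫ u, WAR.innovCov P ε u u ∂μ := by
    refine (integral_congr_ae ?_).trans (WAR.integral_norm_toL2_sq hεm h4 h0)
    filter_upwards [hε' 0] with ω hω
    rw [hω]
  have hnum : ∫ ω, inner ℝ (ε' 0 ω) (ε' 1 ω) ^ 2 ∂P =
      ∫ p, WAR.innovCov P ε p.1 p.2 ^ 2 ∂(μ.prod μ) := by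
    calc _ = ∫ ω, inner ℝ (WAR.toL2 μ (ε 0 ω)) (WAR.toL2 μ (ε 1 ω)) ^ 2 ∂P := by
          refine integral_congr_ae ?_
          filter_upwards [hε' 0, hε' 1] with ω h1 h2
          rw [h1, h2]
      _ = _ := WAR.integral_inner_sq_of_indepFun (hA2.indep.indepFun zero_ne_one)
          (hA2.identDistrib 1)
      _ = _ := WAR.integral_inner_toL2_sq hεm h4 h0
  have main := hAR.tendstoInDistribution_empAutocorr hA1 (hden ▸ hpos)
  rw [hden, hnum] at main
  -- For each `n`, `betaHat` agrees almost surely with the autocorrelation of the causal version,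
  -- which transfers both its limit law and its measurability.
  refine main.congr (fun n => ?_) (ae_of_all _ fun _ => rfl)
  filter_upwards [ae_all_iff.2 hV', ae_all_iff.2 hA3, ae_all_iff.2 hV.tangent.mem_tangent]
    with ω h1 h2 h3
  rw [WAR.betaHat_eq hμ hsupp (fun t => (hV.tangent.measurable t).of_uncurry_left) h2
    (fun t => (h3 t).1)]
  simp only [h1]
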